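/- Consider a queue with Poisson arrivals of rate $\lambda>0$ and $K$ groups of exponential servers. Group $k$ has $M_k$ servers, each with service rate $\mu_k>0$ and operating cost rate $c_k\ge 0$ while it is on; for $k\neq l$ the pairs $(c_k,\mu_k)$ and $(c_l,\mu_l)$ are different. The state $n\in\mathbb N$ is the number of customers in the system, and the holding cost rate $h(n)$ is increasing and convex with $h(n)\to\infty$. A policy $d$ assigns to each state $n$ the numbers $d(n,k)\in\{0,\dots,M_k\}$ of working servers of group $k$, subject to $\sum_k d(n,k)\le n$. Under $d$ the number of customers $n_t$ is the birth-death process with birth rate $\lambda$ and death rate $\sum_k d(n,k)\mu_k$ in state $n$, and the cost rate is $f(n,d(n))=h(n)+\sum_k d(n,k)c_k$. The long-run average cost is $\eta^d=\lim_{T\to\infty}\frac1T\,\mathbb E\int_0^T f(n_t,d(n_t))\,dt$. A policy is optimal if its long-run average cost is finite, the same from every initial state, and minimal over all policies and initial states. The performance potential $g$ of $d$ is, up to an additive constant, $g(n)=\mathbb E\big[\int_0^\infty (f(n_t,d(n_t))-\eta^d)\,dt \,\big|\, n_0=n\big]$, in the sense that $g(n)-g(0)=\lim_{T\to\infty}\big(\mathbb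 E[\int_0^T (f(n_t,d(n_t))-\eta^d)\,dt\mid n_0=n]-\mathbb E[\int_0^T (f(n_t,d(n_t))-\eta^d)\,dt\mid n_0=0]\big)$, and $G(n)=g(n)-g(n-1)$ for $n\ge1$. Assume scale economies: $c_1/\mu_1\le\dots\le c_K/\mu_K$ and $\mu_1\ge\dots\ge\mu_K$. Let $d^*$ be an optimal policy, with average cost $\eta^*$. Then its potential $g^*$ exists, and with $G^*(n)=g^*(n)-g^*(n-1)$ the following hold. 1. The thresholds $\theta_k=\min\{n\ge 1: G^*(n)>c_k/\mu_k\}$ are well defined (the sets are non-empty), and $\theta_1\le\theta_2\le\dots\le\theta_K$. 2. For all $k$ and all $n\ge\theta_k$, group $k$ has as many servers on as possible: $d^*(n,k)=M_k\wedge\big(n-\sum_{l<k}d^*(n,l)\big)$. 3. For all $k$ and all $n<\theta_k$, $d^*(n,k)=0$, unless $n\ge1$ and there is a tie $G^*(n)=c_k/\mu_k$. 4. The multi-threshold policy $d$ with these thresholds, given recursively in $k$ by $d(n,k)=M_k\wedge\big(n-\sum_{l<k}d(n,l)\big)$ if $n\ge\theta_k$ and $d(n,k)=0$ if $n<\theta_k$,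 is also optimal, with the same average cost $\eta^*$. -/

import Mathlib

/-- Data of a group-server queue with `K` groups: Poisson arrival rate `lam`, group sizes `M k`,
service rates `mu k`, operating cost rates `c k` (per working server), holding cost rate `h n`. -/
structure GroupServerQueue (K : ℕ) where
  lam : ℝ
  M : Fin K → ℕ
  mu : Fin K → ℝ
  c : Fin K → ℝ
  h : ℕ → ℝ

namespace GroupServerQueue

open Filter Topology MeasureTheory

variable {K : ℕ} (Q : GroupServerQueue K)

/-- A stationary policy `d` (with `d n k` the number of working servers of group `k` in state `n`)
is efficient if it respects the group sizes and never has more working servers than customers. -/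
def IsEfficient (d : ℕ → Fin K → ℕ) : Prop :=
  ∀ n, (∀ k, d n k ≤ Q.M k) ∧ ∑ k, d n k ≤ n

/-- Total service rate of an action. -/
noncomputable def serviceRate (m : Fin K → ℕ) : ℝ := ∑ k, (m k : ℝ) * Q.mu k

/-- Total cost rate: holding cost plus linear operating cost. -/
noncomputable def costRate (n : ℕ) (m : Fin K → ℕ) : ℝ := Q.h n + ∑ k, (m k : ℝ) * Q.c k

/-- Infinitesimal generator of the number of customers under an efficient policy `d`
(in state `0` an efficient policy has service rate `0`). -/
noncomputable def generator (d : ℕ → Fin K → ℕ) (n m : ℕ) : ℝ :=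
  if m = n + 1 then Q.lam
  else if n = m + 1 then Q.serviceRate (d n)
  else if m = n then -(Q.lam + Q.serviceRate (d n))
  else 0

/-- A uniform bound on the total transition rate out of any state under any policy. -/
noncomputable def unifRate : ℝ := Q.lam + ∑ k, (Q.M k : ℝ) * Q.mu k

/-- The uniformized one-step transition matrix `I + B / Λ`, with `B` the generator and `Λ` the
uniformization rate. -/
noncomputable def jump (d : ℕ → Fin K → ℕ) (n m : ℕ) : ℝ :=
  (if m = n then 1 else 0) + Q.generator d n m / Q.unifRate

/-- Powers of the uniformized matrix (row `n` of `jump` is supported in `{0, …, n + 1}`). -/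
noncomputable def jumpPow (d : ℕ → Fin K → ℕ) : ℕ → ℕ → ℕ → ℝ
  | 0, n, m => if m = n then 1 else 0
  | j + 1, n, m => ∑ l ∈ Finset.range (n + 2), Q.jump d n l * jumpPow d j l m

/-- Transition function `P(n_t = m | n_0 = n)` of the continuous-time Markov chain with generator
`B`, i.e. the `(n, m)` entry of `exp (t B) = ∑ⱼ e^{-Λt} (Λt)^j / j! (I + B/Λ)^j`: the chain jumps by
`I + B/Λ` at the points of a Poisson process of rate `Λ`. -/
noncomputable def trans (d : ℕ → Fin K → ℕ) (t : ℝ) (n m : ℕ) : ℝ :=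
  ∑' j : ℕ, Real.exp (-(Q.unifRate * t)) * (Q.unifRate * t) ^ j / (j.factorial : ℝ)
    * Q.jumpPow d j n m

/-- Expected cost rate at time `t` given `n_0 = n`. -/
noncomputable def meanCost (d : ℕ → Fin K → ℕ) (t : ℝ) (n : ℕ) : ℝ :=
  ∑' m : ℕ, Q.trans d t n m * Q.costRate m (d m)

/-- Started in state `n`, the queue under `d` has the finite long-run average cost `η`: expected
costs over finite horizons are finite, and their time averages converge to `η`. -/
def HasAverageCost (d : ℕ → Fin K → ℕ) (n : ℕ) (η : ℝ) : Prop :=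
  (∀ t : ℝ, 0 ≤ t → Summable fun m : ℕ => Q.trans d t n m * Q.costRate m (d m)) ∧
  (∀ T : ℝ, 0 ≤ T → IntervalIntegrable (fun t => Q.meanCost d t n) volume 0 T) ∧
  Tendsto (fun T : ℝ => 1 / T * ∫ t in (0 : ℝ)..T, Q.meanCost d t n) atTop (𝓝 η)

/-- `d` is an optimal efficient policy with optimal long-run average cost `η`: its cost is `η` from
every initial state, and no efficient policy has a smaller cost from any initial state. -/
def IsOptimal (d : ℕ → Fin K → ℕ) (η : ℝ) : Prop :=
  Q.IsEfficient d ∧ (∀ n, Q.HasAverageCost d n η) ∧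
  ∀ d', Q.IsEfficient d' → ∀ n η', Q.HasAverageCost d' n η' → η ≤ η'

/-- The expected accumulated excess cost `E[∫₀ᵀ (f(n_t, d(n_t)) - η) dt | n_0 = n]`. -/
noncomputable def excessCost (d : ℕ → Fin K → ℕ) (η : ℝ) (T : ℝ) (n : ℕ) : ℝ :=
  ∫ t in (0 : ℝ)..T, (Q.meanCost d t n - η)

/-- `g` is a performance potential (relative value function) of `d`, that is, up to an additive
constant, `g n = E[∫₀^∞ (f(n_t, d(n_t)) - η) dt | n_0 = n]`. Only differences of potentials matter;
they are the limits of the differences of the integrals over `[0, T]`, and these limits make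
sense also when the integrals over `[0, ∞)` do not converge individually. -/
def IsPotential (d : ℕ → Fin K → ℕ) (η : ℝ) (g : ℕ → ℝ) : Prop :=
  ∀ n, Tendsto (fun T : ℝ => Q.excessCost d η T n - Q.excessCost d η T 0) atTop (𝓝 (g n - g 0))

/-- The perturbation realization factor `G(n) = g(n) - g(n-1)`, meaningful for `n ≥ 1`. -/
def prf (g : ℕ → ℝ) (n : ℕ) : ℝ := g n - g (n - 1)

/-- The largest number of servers of group `k` that can be on in state `n` once the groups
`l < k` have `d n l` servers on: `M_k ∧ (n - ∑_{l<k} d(n,l))`. -/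
def maxOn (d : ℕ → Fin K → ℕ) (n : ℕ) (k : Fin K) : ℕ :=
  min (Q.M k) (n - ∑ l ∈ Finset.Iio k, d n l)

/-- `d` is the multi-threshold policy with thresholds `θ`. -/
def IsMultiThreshold (θ : Fin K → ℕ) (d : ℕ → Fin K → ℕ) : Prop :=
  ∀ n k, d n k = if θ k ≤ n then Q.maxOn d n k else 0

end GroupServerQueue

/-! An optimal policy solves a Poisson equation and a Bellman inequality; under scale economies
these reduce to a scalar recursion for `G`, from which the thresholds are read off.

Probability. The number of customers is a birth-death chain with bounded rates, so its semigroup is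
a Poisson mixture of powers of one uniformized step. Finite average cost and `h → ∞` force a nonzero
limit of the occupation measures: a summable weight `w` with `lam * w n = mu (n+1) * w (n+1)`,
supported on `{b, b+1, …}` (`HasAverageCost.exists_weight`). For an optimal policy `b = 0`, since
otherwise one more cheap server would make a cheaper lower state recurrent
(`IsOptimal.bottom_eq_zero`). The mean cost then tends to `η` from every state
(`IsWeight.tendsto_semigroup`). Hence the increments of the accumulated cost converge, the potential
exists, and `lam * G (n+1) = mu n * G n + η - f n`.

Optimality. The weight is an integrating factor of this recursion, so partial sums of `w * (f - η)`
are explicit in `G`. Changing the action in one state changes the weight explicitly, and comparing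
average costs gives the Bellman inequality (`IsOptimal.bellman`): `d n` maximizes `∑ m k * (mu k * G
n - c k)` over admissible `m`. Scale economies and heterogeneity make these values strictly
decreasing in `k` as long as they are positive. By exchange, groups of positive value are filled in
order and groups of negative value are off.

Monotonicity. The Poisson equation becomes `lam * G (n+1) = η - h n + φ n (G n)`, where the maximal
value `φ n x` is increasing in `x`, concave in `n`, and has increments in `n` increasing in `x`.
With `h` convex, one decrease of `G` propagates forever and drives `G` below zero; all servers would
then be off, which positive service rates exclude (`increments_mono_or_neg`). So `G` is increasing,
and it is unbounded because `h` is. The thresholds exist and are ordered as the ratios `c k / mu k`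
are.

Threshold policy. It differs from `d` only at ties, hence in finitely many states, and satisfies the
same Poisson equation, so its average cost is the same (`IsOptimal.of_same_potential`). -/

open Filter Topology MeasureTheory

namespace BirthDeath

/-! ### Averages against Poisson weights -/

/-- The Poisson probability of `j` at rate `r`. -/
noncomputable def poissonWeight (r : ℝ) (j : ℕ) : ℝ :=
  Real.exp (-r) * r ^ j / (j.factorial : ℝ)

/-- The expectation of `a` under the Poisson distribution of rate `r`. -/
noncomputable def poissonAvg (r : ℝ) (a : ℕ → ℝ) : ℝ :=
  ∑' j : ℕ, poissonWeight r j * a j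

theorem poissonWeight_nonneg {r : ℝ} (hr : 0 ≤ r) (j : ℕ) : 0 ≤ poissonWeight r j := by
  unfold poissonWeight; positivity

theorem hasSum_poissonWeight (r : ℝ) : HasSum (poissonWeight r) 1 := by
  have h := (NormedSpace.expSeries_div_hasSum_exp (r : ℝ)).mul_left (Real.exp (-r))
  rw [← Real.exp_eq_exp_ℝ, ← Real.exp_add, neg_add_cancel, Real.exp_zero] at h
  refine h.congr_fun (fun j => ?_)
  simp [poissonWeight, mul_div_assoc]

theorem poissonWeight_succ_mul (r : ℝ) (j : ℕ) :
    poissonWeight r (j + 1) * ((j : ℝ) + 1) = r * poissonWeight r j := by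
  unfold poissonWeight
  have h1 : (j.factorial : ℝ) ≠ 0 := by positivity
  have h2 : (j : ℝ) + 1 ≠ 0 := by positivity
  rw [Nat.factorial_succ]
  push_cast
  field_simp
  ring

theorem summable_poissonWeight_mul {r : ℝ} (hr : 0 ≤ r) {a : ℕ → ℝ} {C : ℝ}
    (ha : ∀ j, |a j| ≤ C) : Summable fun j => poissonWeight r j * a j := by
  refine Summable.of_norm_bounded ((hasSum_poissonWeight r).summable.mul_right C) (fun j => ?_)
  rw [Real.norm_eq_abs, abs_mul, abs_of_nonneg (poissonWeight_nonneg hr j)]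
  exact mul_le_mul_of_nonneg_left (ha j) (poissonWeight_nonneg hr j)

theorem poissonAvg_const (r C : ℝ) : poissonAvg r (fun _ => C) = C := by
  have h := ((hasSum_poissonWeight r).mul_right C).tsum_eq
  rwa [one_mul] at h

theorem poissonAvg_sub {r : ℝ} (hr : 0 ≤ r) {a b : ℕ → ℝ} {A B : ℝ}
    (ha : ∀ j, |a j| ≤ A) (hb : ∀ j, |b j| ≤ B) :
    poissonAvg r (fun j => a j - b j) = poissonAvg r a - poissonAvg r b := by
  unfold poissonAvg
  rw [← (summable_poissonWeight_mul hr ha).tsum_sub (summable_poissonWeight_mul hr hb)]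
  simp only [mul_sub]

theorem poissonAvg_const_mul (r C : ℝ) (a : ℕ → ℝ) :
    poissonAvg r (fun j => C * a j) = C * poissonAvg r a := by
  unfold poissonAvg
  rw [← tsum_mul_left]
  simp only [mul_left_comm]

theorem poissonAvg_sum {r : ℝ} (hr : 0 ≤ r) {ι : Type*} (s : Finset ι) {a : ι → ℕ → ℝ} {A : ι → ℝ}
    (ha : ∀ i j, |a i j| ≤ A i) :
    poissonAvg r (fun j => ∑ i ∈ s, a i j) = ∑ i ∈ s, poissonAvg r (a i) := by
  unfold poissonAvg
  rw [← Summable.tsum_finsetSum (fun i _ => summable_poissonWeight_mul hr (ha i))]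
  simp only [Finset.mul_sum]

theorem poissonAvg_mono {r : ℝ} (hr : 0 ≤ r) {a b : ℕ → ℝ} {A B : ℝ}
    (ha : ∀ j, |a j| ≤ A) (hb : ∀ j, |b j| ≤ B) (hab : ∀ j, a j ≤ b j) :
    poissonAvg r a ≤ poissonAvg r b :=
  (summable_poissonWeight_mul hr ha).tsum_le_tsum
    (fun j => mul_le_mul_of_nonneg_left (hab j) (poissonWeight_nonneg hr j))
    (summable_poissonWeight_mul hr hb)

theorem poissonAvg_le {r : ℝ} (hr : 0 ≤ r) {a : ℕ → ℝ} {A C : ℝ}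
    (ha : ∀ j, |a j| ≤ A) (haC : ∀ j, a j ≤ C) : poissonAvg r a ≤ C := by
  have h := poissonAvg_mono hr ha (b := fun _ => C) (B := |C|) (fun _ => le_rfl) haC
  rwa [poissonAvg_const] at h

theorem abs_poissonAvg_le {r : ℝ} (hr : 0 ≤ r) {a : ℕ → ℝ} {A : ℝ}
    (ha : ∀ j, |a j| ≤ A) : |poissonAvg r a| ≤ A := by
  rw [abs_le]
  refine ⟨?_, poissonAvg_le hr ha (fun j => (abs_le.1 (ha j)).2)⟩
  have h := poissonAvg_mono hr (a := fun _ => -A) (A := |-A|) (fun _ => le_rfl) ha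
    (fun j => (abs_le.1 (ha j)).1)
  rwa [poissonAvg_const] at h

theorem poissonAvg_zero_left (a : ℕ → ℝ) : poissonAvg 0 a = a 0 := by
  unfold poissonAvg
  rw [tsum_eq_single 0]
  · simp [poissonWeight]
  · intro j hj
    simp [poissonWeight, hj]

/-- Termwise differentiation of the exponential series: the rate derivative of a Poisson mean is the
mean of the forward difference. With `a j` the `j`-th iterate of the uniformized step, this is
Kolmogorov's equation. -/
theorem hasDerivAt_poissonAvg {a : ℕ → ℝ} {A : ℝ} (ha : ∀ j, |a j| ≤ A) {r : ℝ} (hr : 0 ≤ r) :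
    HasDerivAt (fun s => poissonAvg s a) (poissonAvg r (fun j => a (j + 1) - a j)) r := by
  have hA : 0 ≤ A := (abs_nonneg _).trans (ha 0)
  have hexp : ∀ s : ℝ, ∀ b : ℕ → ℝ,
      poissonAvg s b = Real.exp (-s) * ∑' j : ℕ, s ^ j / (j.factorial : ℝ) * b j := by
    intro s b
    unfold poissonAvg poissonWeight
    rw [← tsum_mul_left]
    exact tsum_congr fun j => by ring
  set R : ℝ := r + 1 with hR
  have hR0 : 0 ≤ R := by linarith
  have hder : HasDerivAt (fun s : ℝ => ∑' j : ℕ, s ^ j / (j.factorial : ℝ) * a j)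
      (∑' j : ℕ, ((j : ℝ) * r ^ (j - 1) / (j.factorial : ℝ) * a j)) r := by
    refine hasDerivAt_tsum_of_isPreconnected
      (g := fun (j : ℕ) (s : ℝ) => s ^ j / (j.factorial : ℝ) * a j)
      (g' := fun (j : ℕ) (s : ℝ) => (j : ℝ) * s ^ (j - 1) / (j.factorial : ℝ) * a j)
      (u := fun j : ℕ => (j : ℝ) * R ^ (j - 1) / (j.factorial : ℝ) * A)
      (t := Metric.ball (0 : ℝ) R) (y₀ := (0 : ℝ)) ?_ Metric.isOpen_ball (convex_ball _ _).isPreconnected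
      ?_ ?_ ?_ ?_ ?_
    · refine Summable.mul_right A ?_
      rw [← summable_nat_add_iff 1]
      refine (Real.summable_pow_div_factorial R).congr (fun j => ?_)
      rw [Nat.factorial_succ, Nat.add_sub_cancel]
      push_cast
      have h1 : (j.factorial : ℝ) ≠ 0 := by positivity
      have h2 : (j : ℝ) + 1 ≠ 0 := by positivity
      field_simp
    · intro j y _
      exact ((hasDerivAt_pow j y).div_const _).mul_const _
    · intro j y hy
      rw [mem_ball_zero_iff, Real.norm_eq_abs] at hy
      rw [Real.norm_eq_abs, abs_mul, abs_div, abs_mul, abs_pow, Nat.abs_cast, Nat.abs_cast]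
      have := ha j
      gcongr
    · simp [hR]; linarith
    · refine summable_of_ne_finset_zero (s := {0}) (fun j hj => ?_)
      have : j ≠ 0 := by simpa using hj
      simp [this]
    · simp only [mem_ball_zero_iff, Real.norm_eq_abs, abs_of_nonneg hr, hR]; linarith
  have hshift : (∑' j : ℕ, ((j : ℝ) * r ^ (j - 1) / (j.factorial : ℝ) * a j))
      = ∑' j : ℕ, r ^ j / (j.factorial : ℝ) * a (j + 1) := by
    have hs : ∀ j : ℕ, ((j + 1 : ℕ) : ℝ) * r ^ (j + 1 - 1) / ((j + 1).factorial : ℝ) * a (j + 1)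
        = r ^ j / (j.factorial : ℝ) * a (j + 1) := by
      intro j
      rw [Nat.factorial_succ, Nat.add_sub_cancel]
      push_cast
      have h1 : (j.factorial : ℝ) ≠ 0 := by positivity
      have h2 : (j : ℝ) + 1 ≠ 0 := by positivity
      field_simp
    rw [Summable.tsum_eq_zero_add]
    · rw [tsum_congr hs]; simp
    · rw [← summable_nat_add_iff 1]
      simp only [hs]
      refine Summable.of_norm_bounded ((Real.summable_pow_div_factorial r).mul_right A)
        (fun j => ?_)
      rw [Real.norm_eq_abs, abs_mul, abs_of_nonneg (by positivity : 0 ≤ r ^ j / (j.factorial : ℝ))]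
      exact mul_le_mul_of_nonneg_left (ha _) (by positivity)
  rw [hshift] at hder
  have hmul := ((hasDerivAt_id r).neg.exp).mul hder
  have heq : (fun s => poissonAvg s a)
      = (fun s : ℝ => Real.exp (-s)) * fun s : ℝ => ∑' j : ℕ, s ^ j / (j.factorial : ℝ) * a j := by
    funext s; exact hexp s a
  rw [heq, poissonAvg_sub hr (fun j => ha (j + 1)) ha, hexp, hexp]
  refine hmul.congr_deriv ?_
  simp only [Pi.neg_apply, id]
  ring

/-- The Stein-Chen identity `E[N b(N)] = r E[b(N+1)]`. It yields the first two moments, and it also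
turns a forward difference into a factor `N - r`. -/
theorem hasSum_poissonWeight_mul_cast_mul {r s : ℝ} {b : ℕ → ℝ}
    (h : HasSum (fun j => poissonWeight r j * b (j + 1)) s) :
    HasSum (fun j => poissonWeight r j * (j * b j)) (r * s) := by
  have h1 := h.mul_left r
  have h2 : HasSum (fun j : ℕ => poissonWeight r (j + 1) * (((j + 1 : ℕ) : ℝ) * b (j + 1)))
      (r * s) := by
    refine h1.congr_fun (fun j => ?_)
    push_cast
    rw [← mul_assoc, poissonWeight_succ_mul, mul_assoc]
  have h3 := (hasSum_nat_add_iff (f := fun j : ℕ => poissonWeight r j * ((j : ℝ) * b j)) 1).1 h2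
  simpa using h3

theorem hasSum_poissonWeight_mul_sq (r : ℝ) :
    HasSum (fun j => poissonWeight r j * ((j : ℝ) - r) ^ 2) r := by
  have h0 := hasSum_poissonWeight r
  have h1 := hasSum_poissonWeight_mul_cast_mul (b := fun _ => 1) (by simpa using h0)
  have h2 : HasSum (fun j : ℕ => poissonWeight r j * ((j : ℝ) * ((j : ℝ) - 1))) (r * (r * 1)) := by
    refine hasSum_poissonWeight_mul_cast_mul (b := fun j => (j : ℝ) - 1) ?_
    simpa using h1
  have h3 := (h2.add (h1.mul_left (1 - 2 * r))).add (h0.mul_left (r ^ 2))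
  convert! h3 using 1
  · funext j; ring
  · ring

/-- By the Stein-Chen identity, `r` times the left-hand mean is `E[(N - r) a(N)]`, and `E|N - r| ≤
√r` because the variance is `r`. This smoothing drives the convergence to equilibrium. -/
theorem abs_poissonAvg_diff_le {a : ℕ → ℝ} {A : ℝ} (ha : ∀ j, |a j| ≤ A) {r : ℝ} (hr : 0 < r) :
    |poissonAvg r (fun j => a (j + 1) - a j)| ≤ A / Real.sqrt r := by
  have hA : 0 ≤ A := (abs_nonneg _).trans (ha 0)
  have hs : 0 < Real.sqrt r := Real.sqrt_pos.2 hr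
  have hsq : Real.sqrt r * Real.sqrt r = r := Real.mul_self_sqrt hr.le
  have h1 := hasSum_poissonWeight_mul_cast_mul
    (summable_poissonWeight_mul hr.le (fun j => ha (j + 1))).hasSum
  have h2 := (summable_poissonWeight_mul hr.le ha).hasSum.mul_left r
  have h3 := h1.sub h2
  have hval : r * poissonAvg r (fun j => a (j + 1) - a j)
      = ∑' j : ℕ, poissonWeight r j * (((j : ℝ) - r) * a j) := by
    rw [poissonAvg_sub hr.le (fun j => ha (j + 1)) ha, mul_sub]
    refine h3.tsum_eq.symm.trans (tsum_congr fun j => ?_)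
    ring
  -- Instead of Cauchy-Schwarz, `|x| ≤ (√r + x² / √r) / 2` is integrated with `x = N - r`.
  have hb : HasSum (fun j => poissonWeight r j
      * (A * ((Real.sqrt r + ((j : ℝ) - r) ^ 2 / Real.sqrt r) / 2))) (A * Real.sqrt r) := by
    have h4 := (((hasSum_poissonWeight r).mul_left (Real.sqrt r)).add
      ((hasSum_poissonWeight_mul_sq r).mul_left (1 / Real.sqrt r))).mul_left (A / 2)
    convert! h4 using 1
    · funext j; field_simp
    · have : 1 / Real.sqrt r * r = Real.sqrt r := by
        field_simp
        nlinarith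
      rw [this]; ring
  have hle : ‖∑' j : ℕ, poissonWeight r j * (((j : ℝ) - r) * a j)‖ ≤ A * Real.sqrt r := by
    refine tsum_of_norm_bounded hb (fun j => ?_)
    rw [Real.norm_eq_abs, abs_mul, abs_of_nonneg (poissonWeight_nonneg hr.le j), abs_mul]
    refine mul_le_mul_of_nonneg_left ?_ (poissonWeight_nonneg hr.le j)
    rw [mul_comm]
    refine mul_le_mul (ha j) ?_ (abs_nonneg _) hA
    rw [le_div_iff₀ two_pos, ← sq_abs ((j : ℝ) - r), ← sub_nonneg]
    have : Real.sqrt r + |(j : ℝ) - r| ^ 2 / Real.sqrt r - |(j : ℝ) - r| * 2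
        = (Real.sqrt r - |(j : ℝ) - r|) ^ 2 / Real.sqrt r := by
      field_simp
      ring
    rw [this]; positivity
  rw [← hval, Real.norm_eq_abs, abs_mul, abs_of_pos hr] at hle
  rw [le_div_iff₀ hs]
  refine le_of_mul_le_mul_right ?_ hs
  calc |poissonAvg r (fun j => a (j + 1) - a j)| * Real.sqrt r * Real.sqrt r
      = r * |poissonAvg r (fun j => a (j + 1) - a j)| := by rw [mul_assoc, hsq, mul_comm]
    _ ≤ A * Real.sqrt r := hle

theorem tendsto_poissonAvg_diff {a : ℕ → ℝ} {A : ℝ} (ha : ∀ j, |a j| ≤ A) :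
    Tendsto (fun r => poissonAvg r (fun j => a (j + 1) - a j)) atTop (𝓝 0) := by
  refine squeeze_zero_norm' (a := fun r => A / Real.sqrt r) ?_ ?_
  · filter_upwards [eventually_gt_atTop 0] with r hr
    exact abs_poissonAvg_diff_le ha hr
  · exact tendsto_const_nhds.div_atTop Real.tendsto_sqrt_atTop

/-! ### Birth-death semigroups with bounded rates -/

/-- Birth rate `lam`, death rates `mu n`, uniformized by the rate `L`. -/
structure Rates (lam L : ℝ) (mu : ℕ → ℝ) : Prop where
  lam_pos : 0 < lam
  mu_nonneg : ∀ n, 0 ≤ mu n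
  mu_zero : mu 0 = 0
  le_unif : ∀ n, lam + mu n ≤ L

/-- The generator of the birth-death process, acting on functions. -/
noncomputable def gen (lam : ℝ) (mu : ℕ → ℝ) : (ℕ → ℝ) →ₗ[ℝ] (ℕ → ℝ) where
  toFun v n := lam * (v (n + 1) - v n) - mu n * (v n - v (n - 1))
  map_add' u v := by funext n; simp only [Pi.add_apply]; ring
  map_smul' a v := by funext n; simp only [Pi.smul_apply, smul_eq_mul, RingHom.id_apply]; ring

/-- The one-step operator of the uniformized chain. -/
noncomputable def step (lam L : ℝ) (mu : ℕ → ℝ) : Module.End ℝ (ℕ → ℝ) :=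
  1 + (1 / L) • gen lam mu

/-- The transition semigroup of the birth-death process, acting on functions. -/
noncomputable def semigroup (lam L : ℝ) (mu : ℕ → ℝ) (t : ℝ) (v : ℕ → ℝ) (n : ℕ) : ℝ :=
  poissonAvg (L * t) (fun j => (step lam L mu ^ j) v n)

/-- Reversible weights of the birth-death process, supported on `{b, b + 1, …}`. -/
structure IsWeight (lam : ℝ) (mu : ℕ → ℝ) (b : ℕ) (w : ℕ → ℝ) : Prop where
  pos : ∀ n, b ≤ n → 0 < w n
  zero : ∀ n, n < b → w n = 0
  balance : ∀ n, lam * w n = mu (n + 1) * w (n + 1)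
  summable : Summable w

variable {lam L : ℝ} {mu : ℕ → ℝ}

theorem gen_apply (v : ℕ → ℝ) (n : ℕ) :
    gen lam mu v n = lam * (v (n + 1) - v n) - mu n * (v n - v (n - 1)) := rfl

theorem step_apply (v : ℕ → ℝ) (n : ℕ) :
    step lam L mu v n = v n + gen lam mu v n / L := by
  simp [step, div_eq_inv_mul]

theorem step_pow_succ (v : ℕ → ℝ) (j : ℕ) :
    (step lam L mu ^ (j + 1)) v = step lam L mu ((step lam L mu ^ j) v) := by
  rw [pow_succ', Module.End.mul_apply]

theorem step_pow_succ_right (v : ℕ → ℝ) (j : ℕ) :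
    (step lam L mu ^ (j + 1)) v = (step lam L mu ^ j) (step lam L mu v) := by
  rw [pow_succ, Module.End.mul_apply]

theorem step_const (C : ℝ) : step lam L mu (fun _ => C) = fun _ => C := by
  funext n
  simp [step_apply, gen_apply]

theorem step_pow_const (C : ℝ) (j : ℕ) : (step lam L mu ^ j) (fun _ => C) = fun _ => C := by
  induction j with
  | zero => simp
  | succ j ih => rw [step_pow_succ, ih, step_const]

theorem semigroup_zero (v : ℕ → ℝ) (n : ℕ) : semigroup lam L mu 0 v n = v n := by
  simp [semigroup, poissonAvg_zero_left]

namespace Rates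

variable (hR : Rates lam L mu)
include hR

theorem unif_pos : 0 < L := by
  have := hR.le_unif 0
  rw [hR.mu_zero] at this
  linarith [hR.lam_pos]

theorem gen_step_pow (v : ℕ → ℝ) (j n : ℕ) :
    gen lam mu ((step lam L mu ^ j) v) n
      = L * ((step lam L mu ^ (j + 1)) v n - (step lam L mu ^ j) v n) := by
  rw [step_pow_succ, step_apply]
  field_simp [hR.unif_pos.ne']
  ring

theorem step_pow_gen (v : ℕ → ℝ) (j n : ℕ) :
    (step lam L mu ^ j) (gen lam mu v) n
      = L * ((step lam L mu ^ (j + 1)) v n - (step lam L mu ^ j) v n) := by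
  have h : gen lam mu v = L • (step lam L mu v - v) := by
    funext m
    rw [Pi.smul_apply, Pi.sub_apply, step_apply, smul_eq_mul]
    field_simp [hR.unif_pos.ne']
    ring
  rw [h, map_smul, map_sub, Pi.smul_apply, Pi.sub_apply, ← step_pow_succ_right, smul_eq_mul]

theorem step_nonneg {v : ℕ → ℝ} (hv : ∀ n, 0 ≤ v n) (n : ℕ) : 0 ≤ step lam L mu v n := by
  have hL := hR.unif_pos
  have h : step lam L mu v n
      = ((L - lam - mu n) * v n + lam * v (n + 1) + mu n * v (n - 1)) / L := by
    rw [step_apply, gen_apply]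
    field_simp
    ring
  rw [h]
  have h1 : 0 ≤ L - lam - mu n := by linarith [hR.le_unif n]
  have h2 := mul_nonneg h1 (hv n)
  have h3 := mul_nonneg hR.lam_pos.le (hv (n + 1))
  have h4 := mul_nonneg (hR.mu_nonneg n) (hv (n - 1))
  positivity

theorem step_pow_nonneg {v : ℕ → ℝ} (hv : ∀ n, 0 ≤ v n) (j n : ℕ) :
    0 ≤ (step lam L mu ^ j) v n := by
  induction j generalizing n with
  | zero => simpa using hv n
  | succ j ih => rw [step_pow_succ]; exact hR.step_nonneg ih n

theorem step_pow_mono {u v : ℕ → ℝ} (huv : ∀ n, u n ≤ v n) (j n : ℕ) :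
    (step lam L mu ^ j) u n ≤ (step lam L mu ^ j) v n := by
  have h := hR.step_pow_nonneg (v := v - u) (fun n => sub_nonneg.2 (huv n)) j n
  rw [map_sub, Pi.sub_apply] at h
  linarith

theorem abs_step_pow_le {u v : ℕ → ℝ} (huv : ∀ n, |u n| ≤ v n) (j n : ℕ) :
    |(step lam L mu ^ j) u n| ≤ (step lam L mu ^ j) v n := by
  rw [abs_le]
  refine ⟨?_, hR.step_pow_mono (fun n => (abs_le.1 (huv n)).2) j n⟩
  have h := hR.step_pow_mono (u := -v) (v := u) (fun n => (abs_le.1 (huv n)).1) j n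
  rwa [map_neg, Pi.neg_apply] at h

theorem abs_step_pow_le_of_bounded {v : ℕ → ℝ} {C : ℝ} (hv : ∀ n, |v n| ≤ C) (j n : ℕ) :
    |(step lam L mu ^ j) v n| ≤ C := by
  have h := hR.abs_step_pow_le hv j n
  rwa [step_pow_const] at h

/-- Kolmogorov's equation, for functions with bounded iterates at `n`. -/
theorem hasDerivAt_semigroup {v : ℕ → ℝ} {n : ℕ} {C : ℝ}
    (hC : ∀ j, |(step lam L mu ^ j) v n| ≤ C) {t : ℝ} (ht : 0 ≤ t) :
    HasDerivAt (fun s => semigroup lam L mu s v n)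
      (L * poissonAvg (L * t)
        (fun j => (step lam L mu ^ (j + 1)) v n - (step lam L mu ^ j) v n)) t := by
  have h1 := hasDerivAt_poissonAvg hC (mul_nonneg hR.unif_pos.le ht)
  have h2 : HasDerivAt (fun s : ℝ => L * s) L t := by
    simpa using (hasDerivAt_id t).const_mul L
  have h3 := h1.comp t h2
  rw [mul_comm] at h3
  exact h3

theorem continuousOn_semigroup {v : ℕ → ℝ} {n : ℕ} {C : ℝ}
    (hC : ∀ j, |(step lam L mu ^ j) v n| ≤ C) :
    ContinuousOn (fun s => semigroup lam L mu s v n) (Set.Ici 0) :=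
  fun _ ht => (hR.hasDerivAt_semigroup hC ht).continuousAt.continuousWithinAt

theorem intervalIntegrable_semigroup {v : ℕ → ℝ} {n : ℕ} {C : ℝ}
    (hC : ∀ j, |(step lam L mu ^ j) v n| ≤ C) {T : ℝ} (hT : 0 ≤ T) :
    IntervalIntegrable (fun s => semigroup lam L mu s v n) volume 0 T := by
  refine ((hR.continuousOn_semigroup hC).mono ?_).intervalIntegrable
  rw [Set.uIcc_of_le hT]
  exact fun x hx => hx.1

theorem abs_semigroup_le {v : ℕ → ℝ} {n : ℕ} {C : ℝ}
    (hC : ∀ j, |(step lam L mu ^ j) v n| ≤ C) {t : ℝ} (ht : 0 ≤ t) :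
    |semigroup lam L mu t v n| ≤ C :=
  abs_poissonAvg_le (mul_nonneg hR.unif_pos.le ht) hC

/-- The forward form of the integrated Kolmogorov equation. -/
theorem integral_semigroup_gen {v : ℕ → ℝ} {n : ℕ} {C : ℝ}
    (hC : ∀ j, |(step lam L mu ^ j) v n| ≤ C) {T : ℝ} (hT : 0 ≤ T) :
    ∫ t in (0 : ℝ)..T, semigroup lam L mu t (gen lam mu v) n = semigroup lam L mu T v n - v n := by
  have hC' : ∀ j, |(step lam L mu ^ j) (gen lam mu v) n| ≤ L * (C + C) := by
    intro j
    rw [hR.step_pow_gen, abs_mul, abs_of_pos hR.unif_pos]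
    refine mul_le_mul_of_nonneg_left ?_ hR.unif_pos.le
    exact (abs_sub _ _).trans (add_le_add (hC _) (hC _))
  have h := intervalIntegral.integral_eq_sub_of_hasDerivAt (a := 0) (b := T)
    (f := fun s => semigroup lam L mu s v n)
    (f' := fun t => semigroup lam L mu t (gen lam mu v) n) ?_
    (hR.intervalIntegrable_semigroup hC' hT)
  · rw [h, semigroup_zero]
  · intro t ht
    rw [Set.uIcc_of_le hT] at ht
    have h1 := hR.hasDerivAt_semigroup hC ht.1
    rw [← poissonAvg_const_mul] at h1
    simpa only [semigroup, hR.step_pow_gen] using h1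

/-- The backward form of Kolmogorov's equation. The alternative `mu n = 0` serves the lowest state
of a weight: iterates at `n - 1` need not be bounded there, and they do not enter. -/
theorem gen_semigroup {v : ℕ → ℝ} {n : ℕ} {C₀ C₁ C₂ : ℝ}
    (h₀ : mu n = 0 ∨ ∀ j, |(step lam L mu ^ j) v (n - 1)| ≤ C₀)
    (h₁ : ∀ j, |(step lam L mu ^ j) v n| ≤ C₁)
    (h₂ : ∀ j, |(step lam L mu ^ j) v (n + 1)| ≤ C₂) {t : ℝ} (ht : 0 ≤ t) :
    gen lam mu (semigroup lam L mu t v) n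
      = L * poissonAvg (L * t)
        (fun j => (step lam L mu ^ (j + 1)) v n - (step lam L mu ^ j) v n) := by
  have hr : 0 ≤ L * t := mul_nonneg hR.unif_pos.le ht
  rw [← poissonAvg_const_mul]
  simp only [← hR.gen_step_pow, gen_apply]
  rcases h₀ with h₀ | h₀
  · simp only [h₀, zero_mul, sub_zero]
    rw [poissonAvg_const_mul, poissonAvg_sub hr h₂ h₁]
    rfl
  · have e1 : ∀ j, |lam * ((step lam L mu ^ j) v (n + 1) - (step lam L mu ^ j) v n)|
        ≤ lam * (C₂ + C₁) := fun j => by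
      rw [abs_mul, abs_of_pos hR.lam_pos]
      exact mul_le_mul_of_nonneg_left ((abs_sub _ _).trans (add_le_add (h₂ j) (h₁ j)))
        hR.lam_pos.le
    have e2 : ∀ j, |mu n * ((step lam L mu ^ j) v n - (step lam L mu ^ j) v (n - 1))|
        ≤ mu n * (C₁ + C₀) := fun j => by
      rw [abs_mul, abs_of_nonneg (hR.mu_nonneg n)]
      exact mul_le_mul_of_nonneg_left ((abs_sub _ _).trans (add_le_add (h₁ j) (h₀ j)))
        (hR.mu_nonneg n)
    rw [poissonAvg_sub hr e1 e2, poissonAvg_const_mul, poissonAvg_const_mul,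
      poissonAvg_sub hr h₂ h₁, poissonAvg_sub hr h₁ h₀]
    rfl

end Rates

/-! ### Reversible weights and convergence to equilibrium -/

namespace IsWeight

variable {b : ℕ} {w : ℕ → ℝ} (hw : IsWeight lam mu b w)
include hw

theorem nonneg (n : ℕ) : 0 ≤ w n := by
  rcases lt_or_ge n b with h | h
  · rw [hw.zero n h]
  · exact (hw.pos n h).le

theorem tsum_pos : 0 < ∑' n, w n :=
  hw.summable.tsum_pos hw.nonneg b (hw.pos b le_rfl)

theorem mu_bottom (hR : Rates lam L mu) : mu b = 0 := by
  rcases b with _ | b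
  · exact hR.mu_zero
  · have h := hw.balance b
    rw [hw.zero b (Nat.lt_succ_self b), mul_zero] at h
    rcases mul_eq_zero.1 h.symm with h | h
    · exact h
    · exact absurd h (hw.pos _ le_rfl).ne'

/-- Reversible weights are invariant. -/
theorem hasSum_mul_step (hR : Rates lam L mu) {v : ℕ → ℝ} {s : ℝ}
    (hv : HasSum (fun n => w n * v n) s) : HasSum (fun n => w n * step lam L mu v n) s := by
  -- The flow over the edge from `n` to `n + 1`. By balance, births and deaths contribute the same
  -- edge sum, shifted by one index, and cancel.
  set e : ℕ → ℝ := fun n => lam * w n * (v (n + 1) - v n) with he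
  have hsum : Summable e := by
    have h1 : Summable fun n => lam * w n * v n := by
      simpa only [mul_assoc] using hv.summable.mul_left lam
    have h2 : Summable fun n => lam * w n * v (n + 1) := by
      have h3 : Summable fun n => w (n + 1) * v (n + 1) := (summable_nat_add_iff 1).2 hv.summable
      refine Summable.of_norm_bounded (h3.norm.mul_left L) (fun n => ?_)
      rw [hw.balance, mul_assoc, norm_mul, Real.norm_of_nonneg (hR.mu_nonneg _)]
      refine mul_le_mul_of_nonneg_right ?_ (norm_nonneg _)
      linarith [hR.le_unif (n + 1), hR.lam_pos]
    simpa only [he, mul_sub] using h2.sub h1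
  have hshift : HasSum (fun n => mu n * w n * (v n - v (n - 1))) (∑' n, e n) := by
    have h := (hasSum_nat_add_iff (f := fun n => mu n * w n * (v n - v (n - 1))) 1
      (g := ∑' n, e n)).1 ?_
    · simpa [hR.mu_zero] using h
    · refine hsum.hasSum.congr_fun (fun n => ?_)
      simp only [he, Nat.add_sub_cancel, hw.balance]
  have h := hv.add ((hsum.hasSum.sub hshift).div_const L)
  rw [sub_self, zero_div, add_zero] at h
  refine h.congr_fun (fun n => ?_)
  rw [step_apply, gen_apply]
  simp only [he]
  ring

theorem hasSum_mul_step_pow (hR : Rates lam L mu) {v : ℕ → ℝ} {s : ℝ}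
    (hv : HasSum (fun n => w n * v n) s) (j : ℕ) :
    HasSum (fun n => w n * (step lam L mu ^ j) v n) s := by
  induction j with
  | zero => simpa using hv
  | succ j ih => rw [step_pow_succ]; exact hw.hasSum_mul_step hR ih

/-- Invariance keeps the `w`-integral of the iterates of `|v|` constant, and a single state of
positive weight carries at most all of it. This is what lets unbounded costs be treated like bounded
functions. -/
theorem exists_step_pow_bound (hR : Rates lam L mu) {v : ℕ → ℝ}
    (hv : Summable fun n => w n * v n) {n : ℕ} (hn : b ≤ n) :
    ∃ C, ∀ j, |(step lam L mu ^ j) v n| ≤ C := by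
  have hv' : Summable fun n => w n * |v n| := by
    refine hv.abs.congr (fun m => ?_)
    rw [abs_mul, abs_of_nonneg (hw.nonneg m)]
  refine ⟨(∑' n, w n * |v n|) / w n, fun j => ?_⟩
  refine (hR.abs_step_pow_le (v := fun n => |v n|) (fun _ => le_rfl) j n).trans ?_
  rw [le_div_iff₀ (hw.pos n hn), mul_comm]
  exact le_hasSum (hw.hasSum_mul_step_pow hR hv'.hasSum j) n
    (fun m _ => mul_nonneg (hw.nonneg m) (hR.step_pow_nonneg (fun _ => abs_nonneg _) j m))

/-- Poisson smoothing gives `gen (P_t v) → 0` at every state. No death occurs at the bottom, so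
there this says that the first increment of `P_t v` vanishes; each further increment is then
determined by the previous one. -/
theorem tendsto_semigroup_sub_bottom (hR : Rates lam L mu) {v : ℕ → ℝ}
    (hv : Summable fun n => w n * v n) {n : ℕ} (hn : b ≤ n) :
    Tendsto (fun t => semigroup lam L mu t v n - semigroup lam L mu t v b) atTop (𝓝 0) := by
  have hL : Tendsto (fun t : ℝ => L * t) atTop atTop :=
    tendsto_id.const_mul_atTop hR.unif_pos
  have hgen : ∀ m, b ≤ m →
      Tendsto (fun t => gen lam mu (semigroup lam L mu t v) m) atTop (𝓝 0) := by
    intro m hm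
    obtain ⟨C₁, h₁⟩ := hw.exists_step_pow_bound hR hv hm
    obtain ⟨C₂, h₂⟩ := hw.exists_step_pow_bound hR hv (hm.trans (Nat.le_succ m))
    have h₀ : ∃ C₀, mu m = 0 ∨ ∀ j, |(step lam L mu ^ j) v (m - 1)| ≤ C₀ := by
      rcases hm.eq_or_lt with rfl | hlt
      · exact ⟨0, Or.inl (hw.mu_bottom hR)⟩
      · obtain ⟨C₀, h₀⟩ := hw.exists_step_pow_bound hR hv (Nat.le_sub_one_of_lt hlt)
        exact ⟨C₀, Or.inr h₀⟩
    obtain ⟨C₀, h₀⟩ := h₀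
    have h := ((tendsto_poissonAvg_diff h₁).comp hL).const_mul L
    rw [mul_zero] at h
    refine h.congr' ?_
    filter_upwards [eventually_ge_atTop 0] with t ht
    exact (hR.gen_semigroup h₀ h₁ h₂ ht).symm
  have hinc : ∀ m, b ≤ m → Tendsto
      (fun t => semigroup lam L mu t v (m + 1) - semigroup lam L mu t v m) atTop (𝓝 0) := by
    intro m hm
    induction m, hm using Nat.le_induction with
    | base =>
      have h := (hgen b le_rfl).div_const lam
      rw [zero_div] at h
      refine h.congr (fun t => ?_)
      rw [gen_apply, hw.mu_bottom hR]
      field_simp [hR.lam_pos.ne']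
      ring
    | succ m hm ih =>
      have h := ((hgen (m + 1) (by omega)).add (ih.const_mul (mu (m + 1)))).div_const lam
      rw [mul_zero, add_zero, zero_div] at h
      refine h.congr (fun t => ?_)
      rw [gen_apply, Nat.add_sub_cancel]
      field_simp [hR.lam_pos.ne']
      ring
  induction n, hn using Nat.le_induction with
  | base => simp
  | succ m hm ih =>
    have h := (hinc m hm).add ih
    rw [add_zero] at h
    refine h.congr (fun t => ?_)
    ring

/-- By invariance, `∑ w m * P_t v m` over a finite set is at most `s`, while `P_t v` becomes
constant in the state. So `P_t v n` is asymptotically at most `s` over the mass of the finite set,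
which can be taken close to the full mass. -/
theorem eventually_semigroup_le (hR : Rates lam L mu) {v : ℕ → ℝ} {s : ℝ} (hv0 : ∀ n, 0 ≤ v n)
    (hv : HasSum (fun n => w n * v n) s) {n : ℕ} (hn : b ≤ n) {y : ℝ} (hy : s / ∑' n, w n < y) :
    ∀ᶠ t in atTop, semigroup lam L mu t v n < y := by
  have hW := hw.tsum_pos
  have hs0 : 0 ≤ s := hv.nonneg (fun m => mul_nonneg (hw.nonneg m) (hv0 m))
  have hy0 : 0 < y := lt_of_le_of_lt (by positivity) hy
  rw [div_lt_iff₀ hW] at hy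
  obtain ⟨N, hN⟩ : ∃ N, s < y * ∑ m ∈ Finset.range N, w m := by
    have h := (hw.summable.hasSum.tendsto_sum_nat.const_mul y).eventually (lt_mem_nhds hy)
    exact h.exists
  have hle : ∀ t, 0 ≤ t → ∑ m ∈ Finset.range N, w m * semigroup lam L mu t v m ≤ s := by
    intro t ht
    have hr : 0 ≤ L * t := mul_nonneg hR.unif_pos.le ht
    have hb : ∀ m, ∃ C, ∀ j, |w m * (step lam L mu ^ j) v m| ≤ C := by
      intro m
      rcases lt_or_ge m b with h | h
      · exact ⟨0, fun j => by simp [hw.zero m h]⟩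
      · obtain ⟨C, hC⟩ := hw.exists_step_pow_bound hR hv.summable h
        refine ⟨w m * C, fun j => ?_⟩
        rw [abs_mul, abs_of_nonneg (hw.nonneg m)]
        exact mul_le_mul_of_nonneg_left (hC j) (hw.nonneg m)
    choose C hC using hb
    have h1 := poissonAvg_sum hr (Finset.range N) hC
    simp only [poissonAvg_const_mul] at h1
    simp only [semigroup]
    rw [← h1]
    refine poissonAvg_le hr (A := ∑ m ∈ Finset.range N, C m) (fun j => ?_) (fun j => ?_)
    · exact (Finset.abs_sum_le_sum_abs _ _).trans (Finset.sum_le_sum fun m _ => hC m j)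
    · exact sum_le_hasSum _ (fun m _ => mul_nonneg (hw.nonneg m) (hR.step_pow_nonneg hv0 j m))
        (hw.hasSum_mul_step_pow hR hv j)
  set WN := ∑ m ∈ Finset.range N, w m with hWN
  have hWN0 : 0 < WN := by
    by_contra hcon
    have : y * WN ≤ 0 := mul_nonpos_of_nonneg_of_nonpos hy0.le (not_lt.1 hcon)
    linarith
  have hlim : Tendsto (fun t => ∑ m ∈ Finset.range N,
      w m * (semigroup lam L mu t v n - semigroup lam L mu t v m)) atTop (𝓝 0) := by
    rw [← Finset.sum_const_zero (s := Finset.range N)]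
    refine tendsto_finsetSum _ (fun m _ => ?_)
    rcases lt_or_ge m b with h | h
    · simp [hw.zero m h]
    · have h1 := ((hw.tendsto_semigroup_sub_bottom hR hv.summable hn).sub
        (hw.tendsto_semigroup_sub_bottom hR hv.summable h)).const_mul (w m)
      simp only [sub_zero, mul_zero, sub_sub_sub_cancel_right] at h1
      exact h1
  have hpos : 0 < y * WN - s := by linarith
  filter_upwards [hlim.eventually (gt_mem_nhds hpos), eventually_ge_atTop 0] with t h1 h2
  have h3 := hle t h2
  simp only [mul_sub, Finset.sum_sub_distrib, ← Finset.sum_mul] at h1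
  refine lt_of_mul_lt_mul_right ?_ hWN0.le
  rw [mul_comm] at h1
  linarith

/-- Convergence to equilibrium, for nonnegative functions. -/
theorem tendsto_semigroup_of_nonneg (hR : Rates lam L mu) {v : ℕ → ℝ} {s : ℝ} (hv0 : ∀ n, 0 ≤ v n)
    (hv : HasSum (fun n => w n * v n) s) {n : ℕ} (hn : b ≤ n) :
    Tendsto (fun t => semigroup lam L mu t v n) atTop (𝓝 (s / ∑' n, w n)) := by
  have hW := hw.tsum_pos
  refine tendsto_order.2 ⟨fun y hy => ?_, fun y hy => hw.eventually_semigroup_le hR hv0 hv hn hy⟩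
  obtain ⟨N, hN⟩ : ∃ N, y * ∑' n, w n < ∑ m ∈ Finset.range N, w m * v m := by
    rw [lt_div_iff₀ hW] at hy
    exact (hv.tendsto_sum_nat.eventually (lt_mem_nhds hy)).exists
  -- The lower bound comes from the upper bound applied to `C - u`, where `u` is a truncation of `v`
  -- and is bounded by `C`.
  set u : ℕ → ℝ := fun m => if m < N then v m else 0 with hu
  set C : ℝ := ∑ m ∈ Finset.range N, v m with hC
  have huv : ∀ m, u m ≤ v m := fun m => by
    simp only [hu]; split_ifs; exacts [le_rfl, hv0 m]
  have hu0 : ∀ m, 0 ≤ u m := fun m => by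
    simp only [hu]; split_ifs; exacts [hv0 m, le_rfl]
  have huC : ∀ m, u m ≤ C := fun m => by
    simp only [hu]
    split_ifs with h
    · exact Finset.single_le_sum (f := v) (fun i _ => hv0 i) (Finset.mem_range.2 h)
    · exact Finset.sum_nonneg fun i _ => hv0 i
  have husum : HasSum (fun m => w m * u m) (∑ m ∈ Finset.range N, w m * v m) := by
    have h : HasSum (fun m => w m * u m) (∑ m ∈ Finset.range N, w m * u m) := by
      refine hasSum_sum_of_ne_finset_zero (fun m hm => ?_)
      simp [hu, Finset.mem_range.not.1 hm]
    convert! h using 1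
    refine Finset.sum_congr rfl (fun m hm => ?_)
    simp [hu, Finset.mem_range.1 hm]
  have hcomp : HasSum (fun m => w m * (C - u m))
      (C * (∑' n, w n) - ∑ m ∈ Finset.range N, w m * v m) := by
    refine ((hw.summable.hasSum.mul_left C).sub husum).congr_fun (fun m => ?_)
    ring
  have hlt : (C * (∑' n, w n) - ∑ m ∈ Finset.range N, w m * v m) / ∑' n, w n < C - y := by
    rw [div_lt_iff₀ hW]; linarith
  filter_upwards [hw.eventually_semigroup_le hR (fun m => sub_nonneg.2 (huC m)) hcomp hn hlt,
    eventually_ge_atTop 0] with t h1 h2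
  have hr : 0 ≤ L * t := mul_nonneg hR.unif_pos.le h2
  obtain ⟨Cv, hCv⟩ := hw.exists_step_pow_bound hR hv.summable hn
  have hCu : ∀ j, |(step lam L mu ^ j) u n| ≤ C := fun j =>
    hR.abs_step_pow_le_of_bounded (fun m => by rw [abs_of_nonneg (hu0 m)]; exact huC m) j n
  have h3 : semigroup lam L mu t u n ≤ semigroup lam L mu t v n :=
    poissonAvg_mono hr hCu hCv (fun j => hR.step_pow_mono huv j n)
  have h4 : semigroup lam L mu t (fun m => C - u m) n = C - semigroup lam L mu t u n := by
    have h5 : (fun m => C - u m) = (fun _ => C) - u := rfl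
    simp only [semigroup, h5, map_sub, Pi.sub_apply, step_pow_const]
    rw [poissonAvg_sub hr (fun _ => le_rfl) hCu, poissonAvg_const]
  rw [h4] at h1
  linarith

/-- Convergence to equilibrium. -/
theorem tendsto_semigroup (hR : Rates lam L mu) {v : ℕ → ℝ} {s : ℝ}
    (hv : HasSum (fun n => w n * v n) s) {n : ℕ} (hn : b ≤ n) :
    Tendsto (fun t => semigroup lam L mu t v n) atTop (𝓝 (s / ∑' n, w n)) := by
  have habs : Summable fun m => w m * |v m| := by
    refine hv.summable.abs.congr (fun m => ?_)
    rw [abs_mul, abs_of_nonneg (hw.nonneg m)]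
  have hdiff : HasSum (fun m => w m * (|v m| - v m)) ((∑' m, w m * |v m|) - s) := by
    refine (habs.hasSum.sub hv).congr_fun (fun m => ?_)
    ring
  have h := (hw.tendsto_semigroup_of_nonneg hR (fun m => abs_nonneg (v m)) habs.hasSum hn).sub
    (hw.tendsto_semigroup_of_nonneg hR (fun m => sub_nonneg.2 (le_abs_self (v m))) hdiff hn)
  rw [← sub_div, sub_sub_cancel] at h
  refine h.congr' ?_
  filter_upwards [eventually_ge_atTop 0] with t ht
  obtain ⟨C₁, h₁⟩ := hw.exists_step_pow_bound hR habs hn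
  obtain ⟨C₂, h₂⟩ := hw.exists_step_pow_bound hR hdiff.summable hn
  have hvd : v = (fun m => |v m|) - fun m => |v m| - v m := by funext m; simp
  simp only [semigroup]
  rw [← poissonAvg_sub (mul_nonneg hR.unif_pos.le ht) h₁ h₂]
  conv_rhs => rw [hvd]
  simp only [map_sub, Pi.sub_apply]

end IsWeight

end BirthDeath

namespace GroupServerQueue

open BirthDeath

/-! ### The queue as a birth-death semigroup -/

variable {K : ℕ} {Q : GroupServerQueue K} {d : ℕ → Fin K → ℕ}

theorem IsEfficient.apply_zero (hd : Q.IsEfficient d) (k : Fin K) : d 0 k = 0 := by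
  have h := (hd 0).2
  have := Finset.single_le_sum (f := fun k => d 0 k) (fun i _ => Nat.zero_le _) (Finset.mem_univ k)
  omega

theorem serviceRate_nonneg (hmu : ∀ k, 0 < Q.mu k) (m : Fin K → ℕ) : 0 ≤ Q.serviceRate m :=
  Finset.sum_nonneg fun k _ => mul_nonneg (Nat.cast_nonneg _) (hmu k).le

theorem serviceRate_eq_zero_iff (hmu : ∀ k, 0 < Q.mu k) (m : Fin K → ℕ) :
    Q.serviceRate m = 0 ↔ ∀ k, m k = 0 := by
  unfold serviceRate
  rw [Finset.sum_eq_zero_iff_of_nonneg fun k _ => mul_nonneg (Nat.cast_nonneg _) (hmu k).le]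
  refine ⟨fun h k => ?_, fun h k _ => by simp [h k]⟩
  have := h k (Finset.mem_univ k)
  rcases mul_eq_zero.1 this with h | h
  · exact_mod_cast h
  · exact absurd h (hmu k).ne'

theorem IsEfficient.rates (hd : Q.IsEfficient d) (hlam : 0 < Q.lam) (hmu : ∀ k, 0 < Q.mu k) :
    Rates Q.lam Q.unifRate (fun n => Q.serviceRate (d n)) where
  lam_pos := hlam
  mu_nonneg n := serviceRate_nonneg hmu _
  mu_zero := (serviceRate_eq_zero_iff hmu _).2 hd.apply_zero
  le_unif n := by
    unfold unifRate serviceRate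
    refine add_le_add le_rfl (Finset.sum_le_sum fun k _ => ?_)
    exact mul_le_mul_of_nonneg_right (by exact_mod_cast (hd n).1 k) (hmu k).le

/-- The bridge from the matrix to the operator. Vanishing service at `0` matters: `generator` would
subtract that rate on the diagonal, whereas in `gen` the truncation `0 - 1 = 0` cancels it. -/
theorem sum_jump_mul (hz : Q.serviceRate (d 0) = 0) (v : ℕ → ℝ) (n : ℕ) :
    ∑ l ∈ Finset.range (n + 2), Q.jump d n l * v l
      = step Q.lam Q.unifRate (fun n => Q.serviceRate (d n)) v n := by
  rw [step_apply, gen_apply]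
  rcases n with _ | n
  · simp [Finset.sum_range_succ, jump, generator, hz]
    ring
  · rw [Finset.sum_range_succ, Finset.sum_range_succ, Finset.sum_range_succ, Finset.sum_eq_zero]
    · have h0 : n ≠ n + 1 + 1 := by omega
      simp [jump, generator, h0]
      ring
    · intro l hl
      have hl := Finset.mem_range.1 hl
      have h1 : l ≠ n + 1 := by omega
      have h2 : l ≠ n + 1 + 1 := by omega
      have h3 : n ≠ l := by omega
      simp [jump, generator, h1, h2, h3]

theorem jumpPow_eq (hz : Q.serviceRate (d 0) = 0) (j n m : ℕ) :
    Q.jumpPow d j n m = (step Q.lam Q.unifRate (fun n => Q.serviceRate (d n)) ^ j)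
      (fun l => if m = l then 1 else 0) n := by
  induction j generalizing n with
  | zero => simp [jumpPow]
  | succ j ih =>
    rw [step_pow_succ, ← sum_jump_mul hz]
    simp only [jumpPow, ih]

theorem hasSum_jumpPow_mul (hz : Q.serviceRate (d 0) = 0) (v : ℕ → ℝ) (j n : ℕ) :
    HasSum (fun m => Q.jumpPow d j n m * v m)
      ((step Q.lam Q.unifRate (fun n => Q.serviceRate (d n)) ^ j) v n) := by
  induction j generalizing n with
  | zero =>
    simp only [jumpPow, ite_mul, one_mul, zero_mul, pow_zero, Module.End.one_apply]
    exact hasSum_ite_eq n (v n) |>.congr_fun fun m => by split_ifs with h <;> simp [h]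
  | succ j ih =>
    rw [step_pow_succ, ← sum_jump_mul hz]
    have h := hasSum_sum (s := Finset.range (n + 2)) fun l _ => (ih l).mul_left (Q.jump d n l)
    refine h.congr_fun fun m => ?_
    simp only [jumpPow, Finset.sum_mul, mul_assoc]

theorem trans_eq (hz : Q.serviceRate (d 0) = 0) (t : ℝ) (n m : ℕ) :
    Q.trans d t n m = semigroup Q.lam Q.unifRate (fun n => Q.serviceRate (d n)) t
      (fun l => if m = l then 1 else 0) n := by
  simp only [trans, semigroup, poissonAvg, poissonWeight, jumpPow_eq hz]

/-- Fubini for the double sum over the number of jumps and the final state; the bound on the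
iterates of `|v|` gives absolute convergence. -/
theorem hasSum_trans_mul (hR : Rates Q.lam Q.unifRate (fun n => Q.serviceRate (d n)))
    {v : ℕ → ℝ} {n : ℕ} {C : ℝ}
    (hC : ∀ j, |(step Q.lam Q.unifRate (fun n => Q.serviceRate (d n)) ^ j) (fun m => |v m|) n| ≤ C)
    {t : ℝ} (ht : 0 ≤ t) :
    HasSum (fun m => Q.trans d t n m * v m)
      (semigroup Q.lam Q.unifRate (fun n => Q.serviceRate (d n)) t v n) := by
  have hr : 0 ≤ Q.unifRate * t := mul_nonneg hR.unif_pos.le ht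
  have hz := hR.mu_zero
  have hJ : ∀ j m, 0 ≤ Q.jumpPow d j n m := fun j m => by
    rw [jumpPow_eq hz]
    exact hR.step_pow_nonneg (fun l => by split_ifs <;> simp) j n
  have habs : Summable fun p : ℕ × ℕ =>
      poissonWeight (Q.unifRate * t) p.1 * (Q.jumpPow d p.1 n p.2 * |v p.2|) := by
    refine (summable_prod_of_nonneg fun p => mul_nonneg (poissonWeight_nonneg hr _)
      (mul_nonneg (hJ _ _) (abs_nonneg _))).2 ⟨fun j => ?_, ?_⟩
    · exact (hasSum_jumpPow_mul hz (fun m => |v m|) j n).summable.mul_left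
        (poissonWeight (Q.unifRate * t) j)
    · simp only [tsum_mul_left, (hasSum_jumpPow_mul hz (fun m => |v m|) _ n).tsum_eq]
      exact summable_poissonWeight_mul hr hC
  have hsum : Summable fun p : ℕ × ℕ =>
      poissonWeight (Q.unifRate * t) p.1 * (Q.jumpPow d p.1 n p.2 * v p.2) := by
    refine Summable.of_norm ?_
    refine habs.congr fun p => ?_
    rw [Real.norm_eq_abs, abs_mul, abs_mul, abs_of_nonneg (poissonWeight_nonneg hr _),
      abs_of_nonneg (hJ _ _)]
  have h1 := hsum.hasSum.prod_fiberwise fun j =>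
    (hasSum_jumpPow_mul hz v j n).mul_left (poissonWeight (Q.unifRate * t) j)
  have h2 := hsum.prod_symm.hasSum.prod_fiberwise fun m => (hsum.prod_symm.prod_factor m).hasSum
  have h3 := (Equiv.prodComm ℕ ℕ).tsum_eq (fun p : ℕ × ℕ =>
      poissonWeight (Q.unifRate * t) p.1 * (Q.jumpPow d p.1 n p.2 * v p.2))
  have h4 : semigroup Q.lam Q.unifRate (fun n => Q.serviceRate (d n)) t v n
      = ∑' p : ℕ × ℕ, poissonWeight (Q.unifRate * t) p.1 * (Q.jumpPow d p.1 n p.2 * v p.2) :=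
    h1.tsum_eq
  rw [h4, ← h3]
  refine h2.congr_fun fun m => ?_
  unfold trans
  rw [← tsum_mul_right]
  refine tsum_congr fun j => ?_
  simp only [Prod.swap, poissonWeight, mul_assoc]

theorem hasSum_trans (hR : Rates Q.lam Q.unifRate (fun n => Q.serviceRate (d n)))
    {t : ℝ} (ht : 0 ≤ t) (n : ℕ) : HasSum (fun m => Q.trans d t n m) 1 := by
  have h := hasSum_trans_mul hR (v := fun _ => 1) (n := n) (C := 1)
    (fun j => by simp [step_pow_const]) ht
  simpa [semigroup, step_pow_const, poissonAvg_const] using h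

theorem trans_nonneg (hR : Rates Q.lam Q.unifRate (fun n => Q.serviceRate (d n)))
    {t : ℝ} (ht : 0 ≤ t) (n m : ℕ) : 0 ≤ Q.trans d t n m := by
  unfold trans
  refine tsum_nonneg fun j => mul_nonneg
    (poissonWeight_nonneg (mul_nonneg hR.unif_pos.le ht) j) ?_
  rw [jumpPow_eq hR.mu_zero]
  exact hR.step_pow_nonneg (fun l => by split_ifs <;> simp) j n

section Weight

variable {b : ℕ} {w : ℕ → ℝ}

theorem hasSum_trans_mul_of_weight (hR : Rates Q.lam Q.unifRate (fun n => Q.serviceRate (d n)))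
    (hw : IsWeight Q.lam (fun n => Q.serviceRate (d n)) b w) {v : ℕ → ℝ}
    (hv : Summable fun n => w n * v n) {n : ℕ} (hn : b ≤ n) {t : ℝ} (ht : 0 ≤ t) :
    HasSum (fun m => Q.trans d t n m * v m)
      (semigroup Q.lam Q.unifRate (fun n => Q.serviceRate (d n)) t v n) := by
  have habs : Summable fun m => w m * |v m| := by
    refine hv.abs.congr (fun m => ?_)
    rw [abs_mul, abs_of_nonneg (hw.nonneg m)]
  obtain ⟨C, hC⟩ := hw.exists_step_pow_bound hR habs hn
  exact hasSum_trans_mul hR hC ht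

theorem meanCost_eq_semigroup (hR : Rates Q.lam Q.unifRate (fun n => Q.serviceRate (d n)))
    (hw : IsWeight Q.lam (fun n => Q.serviceRate (d n)) b w)
    (hv : Summable fun n => w n * Q.costRate n (d n)) {n : ℕ} (hn : b ≤ n) {t : ℝ} (ht : 0 ≤ t) :
    Q.meanCost d t n = semigroup Q.lam Q.unifRate (fun n => Q.serviceRate (d n)) t
      (fun m => Q.costRate m (d m)) n :=
  (hasSum_trans_mul_of_weight hR hw hv hn ht).tsum_eq

theorem hasSum_costRate_of_hasSum_sub
    (hw : IsWeight Q.lam (fun n => Q.serviceRate (d n)) b w) {η s : ℝ}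
    (hs : HasSum (fun n => w n * (Q.costRate n (d n) - η)) s) :
    HasSum (fun n => w n * Q.costRate n (d n)) (s + η * ∑' n, w n) :=
  (hs.add (hw.summable.hasSum.mul_left η)).congr_fun fun n => by ring

theorem tendsto_meanCost (hR : Rates Q.lam Q.unifRate (fun n => Q.serviceRate (d n)))
    (hw : IsWeight Q.lam (fun n => Q.serviceRate (d n)) b w) {η s : ℝ}
    (hs : HasSum (fun n => w n * (Q.costRate n (d n) - η)) s) {n : ℕ} (hn : b ≤ n) :
    Tendsto (fun t => Q.meanCost d t n) atTop (𝓝 (η + s / ∑' n, w n)) := by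
  have hv := hasSum_costRate_of_hasSum_sub hw hs
  have h := hw.tendsto_semigroup hR hv hn
  rw [add_div, mul_div_assoc, div_self hw.tsum_pos.ne', mul_one, add_comm] at h
  refine h.congr' ?_
  filter_upwards [eventually_ge_atTop 0] with t ht
  exact (meanCost_eq_semigroup hR hw hv.summable hn ht).symm

end Weight

end GroupServerQueue

/-! ### Long-run averages and occupation measures -/

/-- Time averages of a bounded convergent function converge to its limit. -/
theorem tendsto_timeAverage {φ : ℝ → ℝ} {l C : ℝ} (hcont : ContinuousOn φ (Set.Ici 0))
    (hbound : ∀ t, 0 ≤ t → |φ t| ≤ C) (hlim : Tendsto φ atTop (𝓝 l)) :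
    Tendsto (fun T : ℝ => 1 / T * ∫ t in (0 : ℝ)..T, φ t) atTop (𝓝 l) := by
  -- The substitution `t = T * s` turns the average into an integral over the fixed interval `[0,
  -- 1]`, to which dominated convergence applies.
  have h : Tendsto (fun T : ℝ => ∫ s in (0 : ℝ)..1, φ (T * s)) atTop
      (𝓝 (∫ _ in (0 : ℝ)..1, l)) := by
    refine intervalIntegral.tendsto_integral_filter_of_dominated_convergence (fun _ => C)
      ?_ ?_ (intervalIntegrable_const) ?_
    · filter_upwards [eventually_ge_atTop 0] with T hT
      rw [Set.uIoc_of_le zero_le_one]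
      refine ContinuousOn.aestronglyMeasurable ?_ measurableSet_Ioc
      exact hcont.comp (by fun_prop) fun s hs => mul_nonneg hT hs.1.le
    · filter_upwards [eventually_ge_atTop 0] with T hT
      refine Eventually.of_forall fun s hs => ?_
      rw [Set.uIoc_of_le zero_le_one] at hs
      exact hbound _ (mul_nonneg hT hs.1.le)
    · refine Eventually.of_forall fun s hs => ?_
      rw [Set.uIoc_of_le zero_le_one] at hs
      exact hlim.comp (tendsto_id.atTop_mul_const hs.1)
  rw [intervalIntegral.integral_const, sub_zero, one_smul] at h
  refine h.congr' ?_
  filter_upwards [eventually_gt_atTop 0] with T hT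
  rw [intervalIntegral.integral_comp_mul_left _ hT.ne']
  simp

namespace GroupServerQueue

open BirthDeath

variable {K : ℕ} {Q : GroupServerQueue K} {d : ℕ → Fin K → ℕ} {b : ℕ} {w : ℕ → ℝ}

/-- The long-run average cost started in the support of a reversible weight. -/
theorem hasAverageCost_of_weight (hR : Rates Q.lam Q.unifRate (fun n => Q.serviceRate (d n)))
    (hw : IsWeight Q.lam (fun n => Q.serviceRate (d n)) b w) {η s : ℝ}
    (hs : HasSum (fun n => w n * (Q.costRate n (d n) - η)) s) {n : ℕ} (hn : b ≤ n) :
    Q.HasAverageCost d n (η + s / ∑' n, w n) := by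
  have hv := (hasSum_costRate_of_hasSum_sub hw hs).summable
  obtain ⟨C, hC⟩ := hw.exists_step_pow_bound hR hv hn
  have heq : Set.EqOn (fun t => Q.meanCost d t n)
      (fun t => semigroup Q.lam Q.unifRate (fun n => Q.serviceRate (d n)) t
        (fun m => Q.costRate m (d m)) n) (Set.Ici 0) :=
    fun t ht => meanCost_eq_semigroup hR hw hv hn ht
  have hcont : ContinuousOn (fun t => Q.meanCost d t n) (Set.Ici 0) :=
    (hR.continuousOn_semigroup hC).congr heq
  refine ⟨fun t ht => (hasSum_trans_mul_of_weight hR hw hv hn ht).summable, fun T hT => ?_,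
    tendsto_timeAverage hcont (C := C) (fun t ht => ?_) (tendsto_meanCost hR hw hs hn)⟩
  · refine (hcont.mono ?_).intervalIntegrable
    rw [Set.uIcc_of_le hT]
    exact fun x hx => hx.1
  · have := heq ht
    simp only at this
    rw [this]
    exact hR.abs_semigroup_le hC ht

theorem HasAverageCost.unique {n : ℕ} {η η' : ℝ} (h : Q.HasAverageCost d n η)
    (h' : Q.HasAverageCost d n η') : η = η' :=
  tendsto_nhds_unique h.2.2 h'.2.2

/-- The indicator of `{0, …, N}` changes only across the edge from `N` to `N + 1`, so its expected
change over time measures the net flow over that edge. -/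
theorem gen_indicator_le (lam : ℝ) (mu : ℕ → ℝ) (N : ℕ) :
    gen lam mu (fun l => if l ≤ N then 1 else 0)
      = mu (N + 1) • (fun l => if N + 1 = l then (1 : ℝ) else 0)
        - lam • (fun l => if N = l then (1 : ℝ) else 0) := by
  funext l
  simp only [gen_apply, Pi.sub_apply, Pi.smul_apply, smul_eq_mul]
  rcases lt_trichotomy l N with h | rfl | h
  · have h1 : l + 1 ≤ N := h
    have h2 : l ≤ N := h.le
    have h3 : l - 1 ≤ N := by omega
    have h4 : N + 1 ≠ l := by omega
    have h5 : N ≠ l := by omega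
    simp [h1, h2, h3, h4, h5]
  · have h3 : l - 1 ≤ l := by omega
    simp [h3]
  · rcases eq_or_lt_of_le (Nat.succ_le_of_lt h) with rfl | h'
    · simp
    · have h1 : ¬ l + 1 ≤ N := by omega
      have h2 : ¬ l ≤ N := by omega
      have h3 : ¬ l - 1 ≤ N := by omega
      have h4 : N + 1 ≠ l := by omega
      have h5 : N ≠ l := by omega
      simp [h1, h2, h3, h4, h5]

theorem le_costRate (hc : ∀ k, 0 ≤ Q.c k) (n : ℕ) (m : Fin K → ℕ) : Q.h n ≤ Q.costRate n m :=
  le_add_of_nonneg_right (Finset.sum_nonneg fun k _ => mul_nonneg (Nat.cast_nonneg _) (hc k))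

/-- Subtracting `h 0`, a lower bound of all cost rates, makes the integrands below nonnegative; `h`
itself may take negative values. -/
theorem integral_meanCost_sub {n : ℕ} {η : ℝ} (hη : Q.HasAverageCost d n η) {T : ℝ} (hT : 0 < T) :
    1 / T * ∫ t in (0 : ℝ)..T, (Q.meanCost d t n - Q.h 0)
      = 1 / T * (∫ t in (0 : ℝ)..T, Q.meanCost d t n) - Q.h 0 := by
  rw [intervalIntegral.integral_sub (hη.2.1 T hT.le) intervalIntegrable_const,
    intervalIntegral.integral_const]
  simp only [smul_eq_mul]
  field_simp
  ring

/-- The fraction of time spent in `m` up to time `T`. -/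
noncomputable def occupation (Q : GroupServerQueue K) (d : ℕ → Fin K → ℕ) (n : ℕ) (T : ℝ)
    (m : ℕ) : ℝ :=
  1 / T * ∫ t in (0 : ℝ)..T, Q.trans d t n m

section Occupation

variable (hR : Rates Q.lam Q.unifRate (fun n => Q.serviceRate (d n)))
include hR

theorem intervalIntegrable_trans (n m : ℕ) {T : ℝ} (hT : 0 ≤ T) :
    IntervalIntegrable (fun t => Q.trans d t n m) volume 0 T := by
  simp only [trans_eq hR.mu_zero]
  refine hR.intervalIntegrable_semigroup (C := 1) (fun j => ?_) hT
  exact hR.abs_step_pow_le_of_bounded (fun l => by split_ifs <;> simp) j n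

theorem occupation_nonneg (n m : ℕ) {T : ℝ} (hT : 0 ≤ T) : 0 ≤ Q.occupation d n T m :=
  mul_nonneg (by positivity) (intervalIntegral.integral_nonneg hT
    fun t ht => trans_nonneg hR ht.1 n m)

theorem sum_mul_occupation (n : ℕ) {T : ℝ} (hT : 0 ≤ T) (s : Finset ℕ) (a : ℕ → ℝ) :
    ∑ m ∈ s, a m * Q.occupation d n T m
      = 1 / T * ∫ t in (0 : ℝ)..T, ∑ m ∈ s, a m * Q.trans d t n m := by
  rw [intervalIntegral.integral_finsetSum
    fun m _ => (intervalIntegrable_trans hR n m hT).const_mul (a m), Finset.mul_sum]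
  refine Finset.sum_congr rfl fun m _ => ?_
  rw [intervalIntegral.integral_const_mul, occupation]
  ring

theorem sum_occupation_le_one (n : ℕ) {T : ℝ} (hT : 0 < T) (s : Finset ℕ) :
    ∑ m ∈ s, Q.occupation d n T m ≤ 1 := by
  have h := sum_mul_occupation hR n hT.le s (fun _ => 1)
  simp only [one_mul] at h
  rw [h, one_div, inv_mul_le_iff₀ hT, mul_one]
  have h1 := intervalIntegral.integral_mono_on (a := 0) (b := T) (μ := volume) hT.le
    (f := fun t => ∑ m ∈ s, Q.trans d t n m) (g := fun _ => (1 : ℝ))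
    (by
      have := IntervalIntegrable.sum s fun m _ => intervalIntegrable_trans hR n m hT.le
      simpa only [Finset.sum_fn] using this)
    intervalIntegrable_const
    (fun t ht => sum_le_hasSum s (fun m _ => trans_nonneg hR ht.1 n m) (hasSum_trans hR ht.1 n))
  simpa using h1

/-- The net flow over an edge up to time `T` is a difference of two values in `[-1, 1]`, so
occupation fractions satisfy detailed balance up to `2 / T`. -/
theorem abs_balance_occupation_le (n N : ℕ) {T : ℝ} (hT : 0 < T) :
    |Q.serviceRate (d (N + 1)) * Q.occupation d n T (N + 1) - Q.lam * Q.occupation d n T N|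
      ≤ 2 / T := by
  set mu : ℕ → ℝ := fun n => Q.serviceRate (d n) with hmu
  have hind : ∀ m j, |(step Q.lam Q.unifRate mu ^ j)
      (fun l => if m = l then (1 : ℝ) else 0) n| ≤ 1 := fun m j =>
    hR.abs_step_pow_le_of_bounded (fun l => by split_ifs <;> simp) j n
  have hle : ∀ j, |(step Q.lam Q.unifRate mu ^ j)
      (fun l => if l ≤ N then (1 : ℝ) else 0) n| ≤ 1 := fun j =>
    hR.abs_step_pow_le_of_bounded (fun l => by split_ifs <;> simp) j n
  have h1 := hR.integral_semigroup_gen hle hT.le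
  have h2 : ∀ t ∈ Set.uIcc 0 T, semigroup Q.lam Q.unifRate mu t
      (gen Q.lam mu (fun l => if l ≤ N then (1 : ℝ) else 0)) n
      = mu (N + 1) * Q.trans d t n (N + 1) - Q.lam * Q.trans d t n N := by
    intro t ht
    rw [Set.uIcc_of_le hT.le] at ht
    have hr : 0 ≤ Q.unifRate * t := mul_nonneg hR.unif_pos.le ht.1
    rw [gen_indicator_le, trans_eq hR.mu_zero, trans_eq hR.mu_zero]
    simp only [semigroup, map_sub, map_smul, Pi.sub_apply, Pi.smul_apply, smul_eq_mul]
    rw [poissonAvg_sub hr (A := |mu (N + 1)|) (B := |Q.lam|), poissonAvg_const_mul,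
      poissonAvg_const_mul]
    · intro j
      rw [abs_mul]
      exact mul_le_of_le_one_right (abs_nonneg _) (hind _ j)
    · intro j
      rw [abs_mul]
      exact mul_le_of_le_one_right (abs_nonneg _) (hind _ j)
  rw [intervalIntegral.integral_congr h2, intervalIntegral.integral_sub
    ((intervalIntegrable_trans hR n _ hT.le).const_mul _)
    ((intervalIntegrable_trans hR n _ hT.le).const_mul _),
    intervalIntegral.integral_const_mul, intervalIntegral.integral_const_mul] at h1
  have h3 : Q.serviceRate (d (N + 1)) * Q.occupation d n T (N + 1)
      - Q.lam * Q.occupation d n T N = 1 / T * (semigroup Q.lam Q.unifRate mu T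
        (fun l => if l ≤ N then (1 : ℝ) else 0) n - if n ≤ N then 1 else 0) := by
    rw [← h1]
    simp only [occupation, hmu]
    ring
  rw [h3, abs_mul, abs_of_pos (by positivity : 0 < 1 / T), one_div, inv_mul_le_iff₀ hT,
    mul_div_cancel₀ _ hT.ne']
  refine (abs_sub _ _).trans ?_
  have h4 := hR.abs_semigroup_le hle hT.le
  have h5 : |(if n ≤ N then 1 else 0 : ℝ)| ≤ 1 := by split_ifs <;> simp
  linarith

variable {n : ℕ} {η : ℝ} (hη : Q.HasAverageCost d n η)
include hη

theorem hasSum_trans_mul_excess {t : ℝ} (ht : 0 ≤ t) :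
    HasSum (fun m => Q.trans d t n m * (Q.costRate m (d m) - Q.h 0)) (Q.meanCost d t n - Q.h 0) := by
  have h := (hη.1 t ht).hasSum.sub ((hasSum_trans hR ht n).mul_right (Q.h 0))
  rw [one_mul] at h
  exact h.congr_fun fun m => by ring

variable (hc : ∀ k, 0 ≤ Q.c k) (h_mono : Monotone Q.h)
include hc h_mono

theorem sum_excess_mul_occupation_le {T : ℝ} (hT : 0 < T) (s : Finset ℕ) :
    ∑ m ∈ s, (Q.costRate m (d m) - Q.h 0) * Q.occupation d n T m
      ≤ 1 / T * (∫ t in (0 : ℝ)..T, Q.meanCost d t n) - Q.h 0 := by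
  rw [sum_mul_occupation hR n hT.le, ← integral_meanCost_sub hη hT]
  refine mul_le_mul_of_nonneg_left ?_ (by positivity)
  refine intervalIntegral.integral_mono_on hT.le ?_
    ((hη.2.1 T hT.le).sub intervalIntegrable_const) fun t ht => ?_
  · have := IntervalIntegrable.sum s fun m _ =>
      (intervalIntegrable_trans hR n m hT.le).const_mul (Q.costRate m (d m) - Q.h 0)
    simpa only [Finset.sum_fn] using this
  · simp only [mul_comm (Q.costRate _ _ - Q.h 0)]
    refine sum_le_hasSum s (fun m _ => mul_nonneg (trans_nonneg hR ht.1 n m) ?_)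
      (hasSum_trans_mul_excess hR hη ht.1)
    linarith [le_costRate hc m (d m), h_mono (Nat.zero_le m)]

/-- Markov's inequality: time spent at or above `N` costs at least `h N`. This keeps mass from
escaping to infinity. -/
theorem tail_occupation_le {T : ℝ} (hT : 0 < T) (N : ℕ) :
    (Q.h N - Q.h 0) * (1 - ∑ m ∈ Finset.range N, Q.occupation d n T m)
      ≤ 1 / T * (∫ t in (0 : ℝ)..T, Q.meanCost d t n) - Q.h 0 := by
  have h0 := sum_mul_occupation hR n hT.le (Finset.range N) (fun _ => 1)
  simp only [one_mul] at h0
  have h_integrable : IntervalIntegrable (fun t => ∑ m ∈ Finset.range N, Q.trans d t n m) volume 0 T := by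
    have := IntervalIntegrable.sum (Finset.range N)
      fun m _ => intervalIntegrable_trans hR n m hT.le
    simpa only [Finset.sum_fn] using this
  have h1 : (Q.h N - Q.h 0) * (1 - ∑ m ∈ Finset.range N, Q.occupation d n T m)
      = 1 / T * ∫ t in (0 : ℝ)..T,
        (Q.h N - Q.h 0) * (1 - ∑ m ∈ Finset.range N, Q.trans d t n m) := by
    rw [intervalIntegral.integral_const_mul, intervalIntegral.integral_sub
      intervalIntegrable_const h_integrable, h0, intervalIntegral.integral_const]
    simp only [smul_eq_mul]
    field_simp
    ring
  rw [h1, ← integral_meanCost_sub hη hT]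
  refine mul_le_mul_of_nonneg_left ?_ (by positivity)
  refine intervalIntegral.integral_mono_on hT.le
    ((intervalIntegrable_const.sub h_integrable).const_mul _)
    ((hη.2.1 T hT.le).sub intervalIntegrable_const) fun t ht => ?_
  have h2 : HasSum (fun m => if m < N then Q.trans d t n m else 0)
      (∑ m ∈ Finset.range N, Q.trans d t n m) := by
    have h : HasSum (fun m => if m < N then Q.trans d t n m else 0)
        (∑ m ∈ Finset.range N, if m < N then Q.trans d t n m else 0) :=
      hasSum_sum_of_ne_finset_zero fun m hm => by simp [Finset.mem_range.not.1 hm]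
    convert! h using 1
    exact Finset.sum_congr rfl fun m hm => by simp [Finset.mem_range.1 hm]
  refine hasSum_le (fun m => ?_) (((hasSum_trans hR ht.1 n).sub h2).mul_left (Q.h N - Q.h 0))
    (hasSum_trans_mul_excess hR hη ht.1)
  have h3 := trans_nonneg hR ht.1 n m
  have h4 := le_costRate hc m (d m)
  split_ifs with h
  · rw [sub_self, mul_zero]
    exact mul_nonneg h3 (by linarith [h_mono (Nat.zero_le m)])
  · rw [sub_zero, mul_comm]
    exact mul_le_mul_of_nonneg_left (by linarith [h_mono (not_lt.1 h)]) h3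

/-- A policy with finite average cost has reversible weights, and these integrate the cost. -/
theorem HasAverageCost.exists_weight (h_top : Tendsto Q.h atTop atTop) :
    ∃ b w, IsWeight Q.lam (fun n => Q.serviceRate (d n)) b w ∧
      Summable fun m => w m * Q.costRate m (d m) := by
  -- Limits along an ultrafilter replace a diagonal subsequence: all occupation fractions converge
  -- at once.
  obtain ⟨U, hU⟩ : ∃ U : Ultrafilter ℝ, (U : Filter ℝ) ≤ atTop :=
    ⟨Ultrafilter.of atTop, Ultrafilter.of_le _⟩
  have hposU : ∀ᶠ T in (U : Filter ℝ), 0 < T := hU (eventually_gt_atTop 0)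
  have hlim : ∀ m, ∃ x, Tendsto (fun T => Q.occupation d n T m) U (𝓝 x) := by
    intro m
    have hmem : Set.Icc (0 : ℝ) 1 ∈ U.map (fun T => Q.occupation d n T m) := by
      refine Ultrafilter.mem_map.2 (Filter.mem_of_superset hposU fun T hT => ?_)
      have h1 := sum_occupation_le_one hR n hT {m}
      rw [Finset.sum_singleton] at h1
      exact ⟨occupation_nonneg hR n m (le_of_lt hT), h1⟩
    obtain ⟨x, -, hx⟩ := isCompact_Icc.ultrafilter_le_nhds' _ hmem
    exact ⟨x, hx⟩
  choose x hx using hlim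
  have hx0 : ∀ m, 0 ≤ x m := fun m => ge_of_tendsto (hx m)
    (hposU.mono fun T hT => occupation_nonneg hR n m hT.le)
  have hx1 : ∀ N, ∑ m ∈ Finset.range N, x m ≤ 1 := fun N =>
    le_of_tendsto (tendsto_finsetSum _ fun m _ => hx m)
      (hposU.mono fun T hT => sum_occupation_le_one hR n hT _)
  have hlimη : Tendsto (fun T : ℝ => 1 / T * (∫ t in (0 : ℝ)..T, Q.meanCost d t n) - Q.h 0) U
      (𝓝 (η - Q.h 0)) := (hη.2.2.mono_left hU).sub_const _
  have hxf : ∀ N, ∑ m ∈ Finset.range N, (Q.costRate m (d m) - Q.h 0) * x m ≤ η - Q.h 0 :=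
    fun N => le_of_tendsto_of_tendsto (tendsto_finsetSum _ fun m _ => (hx m).const_mul _) hlimη
      (hposU.mono fun T hT => sum_excess_mul_occupation_le hR hη hc h_mono hT _)
  have htail : ∀ N, (Q.h N - Q.h 0) * (1 - ∑ m ∈ Finset.range N, x m) ≤ η - Q.h 0 :=
    fun N => le_of_tendsto_of_tendsto
      ((tendsto_const_nhds.sub (tendsto_finsetSum _ fun m _ => hx m)).const_mul _) hlimη
      (hposU.mono fun T hT => tail_occupation_le hR hη hc h_mono hT N)
  have hbal : ∀ N, Q.lam * x N = Q.serviceRate (d (N + 1)) * x (N + 1) := by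
    intro N
    have h1 := ((hx (N + 1)).const_mul (Q.serviceRate (d (N + 1)))).sub ((hx N).const_mul Q.lam)
    have h2 : Tendsto (fun T => Q.serviceRate (d (N + 1)) * Q.occupation d n T (N + 1)
        - Q.lam * Q.occupation d n T N) U (𝓝 0) := by
      refine squeeze_zero_norm' (a := fun T => 2 / T)
        (hposU.mono fun T hT => abs_balance_occupation_le hR n N hT) ?_
      exact (tendsto_const_nhds.div_atTop tendsto_id).mono_left hU
    linarith [tendsto_nhds_unique h1 h2]
  -- If all limits vanished, the tail bound would give `h N ≤ η` for every `N`.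
  have hex : ∃ m, 0 < x m := by
    by_contra hcon
    push Not at hcon
    have hzero : ∀ m, x m = 0 := fun m => le_antisymm (hcon m) (hx0 m)
    obtain ⟨N, hN⟩ := (h_top.eventually_gt_atTop η).exists
    have := htail N
    simp only [hzero, Finset.sum_const_zero, sub_zero, mul_one] at this
    linarith
  have hsx : Summable x := summable_of_sum_range_le hx0 hx1
  classical
  -- The first state of positive mass is the bottom; balance carries positivity upwards from it.
  refine ⟨Nat.find hex, x, ⟨fun m hm => ?_, fun m hm => ?_, hbal, hsx⟩, ?_⟩
  · induction m, hm using Nat.le_induction with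
    | base => exact Nat.find_spec hex
    | succ m hm ih =>
      refine (hx0 _).lt_of_ne fun h => ?_
      have h1 := hbal m
      rw [← h, mul_zero] at h1
      exact (mul_pos hR.lam_pos ih).ne' h1
  · exact le_antisymm (not_lt.1 (Nat.find_min hex hm)) (hx0 m)
  · have h1 : Summable fun m => (Q.costRate m (d m) - Q.h 0) * x m :=
      summable_of_sum_range_le (fun m => mul_nonneg
        (by linarith [le_costRate hc m (d m), h_mono (Nat.zero_le m)]) (hx0 m)) hxf
    exact (h1.add (hsx.mul_left (Q.h 0))).congr fun m => by ring

end Occupation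

variable {η : ℝ}

/-! ### The potential -/

section Potential

variable (hR : Rates Q.lam Q.unifRate (fun n => Q.serviceRate (d n)))
  (hw : IsWeight Q.lam (fun n => Q.serviceRate (d n)) 0 w)
  (hs : HasSum (fun n => w n * (Q.costRate n (d n) - η)) 0)
include hR hw hs

/-- The change of the mean cost is the integral of `P_t (gen f)` by the forward equation. By the
backward equation it is also that of `gen (P_t f)`, and `gen` commutes with the time integral. -/
theorem meanCost_sub_costRate {T : ℝ} (hT : 0 ≤ T) (n : ℕ) :
    Q.meanCost d T n - Q.costRate n (d n)
      = Q.lam * (Q.excessCost d η T (n + 1) - Q.excessCost d η T n)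
        - Q.serviceRate (d n) * (Q.excessCost d η T n - Q.excessCost d η T (n - 1)) := by
  set mu : ℕ → ℝ := fun n => Q.serviceRate (d n) with hmu
  set f : ℕ → ℝ := fun n => Q.costRate n (d n) with hf
  have hv := (hasSum_costRate_of_hasSum_sub hw hs).summable
  have hmean : ∀ m t, 0 ≤ t → Q.meanCost d t m = semigroup Q.lam Q.unifRate mu t f m :=
    fun m t ht => meanCost_eq_semigroup hR hw hv (Nat.zero_le m) ht
  have hbd : ∀ m, ∃ C, ∀ j, |(step Q.lam Q.unifRate mu ^ j) f m| ≤ C :=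
    fun m => hw.exists_step_pow_bound hR hv (Nat.zero_le m)
  choose C hC using hbd
  have h_integrable : ∀ m, IntervalIntegrable (fun t => Q.meanCost d t m - η) volume 0 T := fun m =>
    ((hasAverageCost_of_weight hR hw hs (Nat.zero_le m)).2.1 T hT).sub intervalIntegrable_const
  rw [hmean n T hT]
  change _ - f n = _ - mu n * _
  rw [← hR.integral_semigroup_gen (hC n) hT]
  simp only [excessCost]
  rw [← intervalIntegral.integral_sub (h_integrable _) (h_integrable _),
    ← intervalIntegral.integral_sub (h_integrable _) (h_integrable _),
    ← intervalIntegral.integral_const_mul, ← intervalIntegral.integral_const_mul,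
    ← intervalIntegral.integral_sub (((h_integrable _).sub (h_integrable _)).const_mul _)
      (((h_integrable _).sub (h_integrable _)).const_mul _)]
  refine intervalIntegral.integral_congr fun t ht => ?_
  rw [Set.uIcc_of_le hT] at ht
  have h1 := hR.gen_semigroup (Or.inr (hC (n - 1))) (hC n) (hC (n + 1)) ht.1
  rw [← poissonAvg_const_mul] at h1
  simp only [← hR.step_pow_gen] at h1
  simp only [hmean _ t ht.1, sub_sub_sub_cancel_right]
  exact h1.symm

/-- The mean cost converges, so the previous identity, solved for the increment above `n`, passes
convergence upwards. At `n = 0` the lower increment is zero. -/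
theorem exists_tendsto_excessCost_sub (n : ℕ) :
    ∃ x, Tendsto (fun T => Q.excessCost d η T (n + 1) - Q.excessCost d η T n) atTop (𝓝 x) := by
  have hlim : ∀ n, Tendsto (fun T => Q.meanCost d T n - Q.costRate n (d n)) atTop
      (𝓝 (η - Q.costRate n (d n))) := fun n => by
    have h := tendsto_meanCost hR hw hs (Nat.zero_le n)
    rw [zero_div, add_zero] at h
    exact h.sub_const _
  have hstep : ∀ n y, Tendsto (fun T => Q.serviceRate (d n)
      * (Q.excessCost d η T n - Q.excessCost d η T (n - 1))) atTop (𝓝 y) →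
      ∃ x, Tendsto (fun T => Q.excessCost d η T (n + 1) - Q.excessCost d η T n) atTop (𝓝 x) := by
    intro n y hy
    refine ⟨_, (((hlim n).add hy).div_const Q.lam).congr' ?_⟩
    filter_upwards [eventually_ge_atTop 0] with T hT
    rw [meanCost_sub_costRate hR hw hs hT n]
    field_simp [hR.lam_pos.ne']
    ring
  induction n with
  | zero =>
    refine hstep 0 0 ?_
    simp
  | succ n ih =>
    obtain ⟨x, hx⟩ := ih
    exact hstep (n + 1) _ (hx.const_mul _)

theorem exists_isPotential : ∃ g, Q.IsPotential d η g := by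
  choose G hG using exists_tendsto_excessCost_sub hR hw hs
  refine ⟨fun n => ∑ i ∈ Finset.range n, G i, fun n => ?_⟩
  simp only [Finset.range_zero, Finset.sum_empty, sub_zero]
  refine (tendsto_finsetSum (Finset.range n) fun i _ => hG i).congr fun T => ?_
  exact Finset.sum_range_sub (fun i => Q.excessCost d η T i) n

/-- The Poisson equation, in terms of the increments of the potential. -/
theorem IsPotential.lam_mul_prf_succ {g : ℕ → ℝ} (hg : Q.IsPotential d η g) (n : ℕ) :
    Q.lam * prf g (n + 1) = Q.serviceRate (d n) * prf g n + η - Q.costRate n (d n) := by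
  have h0 : ∀ n m, Tendsto (fun T => Q.excessCost d η T n - Q.excessCost d η T m) atTop
      (𝓝 (g n - g m)) := fun n m => by
    have h := (hg n).sub (hg m)
    simpa only [sub_sub_sub_cancel_right] using h
  have h1 := tendsto_meanCost hR hw hs (Nat.zero_le n)
  rw [zero_div, add_zero] at h1
  have h2 := ((h0 (n + 1) n).const_mul Q.lam).sub ((h0 n (n - 1)).const_mul (Q.serviceRate (d n)))
  have h3 := tendsto_nhds_unique_of_eventuallyEq (h1.sub_const (Q.costRate n (d n))) h2
    ((eventually_ge_atTop 0).mono fun T hT => meanCost_sub_costRate hR hw hs hT n)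
  simp only [prf, Nat.add_sub_cancel]
  linarith

end Potential

/-- The weight is an integrating factor of the recursion for `G`, so the sum telescopes. -/
theorem sum_weight_mul_excess {lam : ℝ} {mu f G w : ℕ → ℝ} (h0 : mu 0 = 0)
    (hbal : ∀ n, lam * w n = mu (n + 1) * w (n + 1))
    (hG : ∀ n, lam * G (n + 1) = mu n * G n + η - f n) (n : ℕ) :
    ∑ i ∈ Finset.range (n + 1), w i * (f i - η) = -(lam * w n * G (n + 1)) := by
  induction n with
  | zero =>
    have h := hG 0
    rw [h0, zero_mul, zero_add] at h
    rw [Finset.sum_range_one]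
    linear_combination w 0 * h
  | succ n ih =>
    rw [Finset.sum_range_succ, ih]
    linear_combination w (n + 1) * hG (n + 1) - G (n + 1) * hbal n

/-! ### Optimal policies -/

/-- Conservation of work: in equilibrium the throughput equals the arrival rate. -/
theorem hasSum_mul_serviceRate (hR : Rates Q.lam Q.unifRate (fun n => Q.serviceRate (d n)))
    (hw : IsWeight Q.lam (fun n => Q.serviceRate (d n)) b w) :
    HasSum (fun n => w n * Q.serviceRate (d n)) (Q.lam * ∑' n, w n) := by
  have h := (hasSum_nat_add_iff (f := fun n => w n * Q.serviceRate (d n)) 1).1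
    ((hw.summable.hasSum.mul_left Q.lam).congr_fun fun n => by rw [hw.balance n, mul_comm])
  have h0 : Q.serviceRate (d 0) = 0 := hR.mu_zero
  simpa [h0] using h

theorem serviceRate_pos_of_weight (hR : Rates Q.lam Q.unifRate (fun n => Q.serviceRate (d n)))
    (hw : IsWeight Q.lam (fun n => Q.serviceRate (d n)) b w) {n : ℕ} (hn : b < n) :
    0 < Q.serviceRate (d n) := by
  obtain ⟨n, rfl⟩ := Nat.exists_eq_succ_of_ne_zero (Nat.ne_zero_of_lt hn)
  refine (hR.mu_nonneg _).lt_of_ne fun h => ?_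
  have h1 : Q.lam * w n = Q.serviceRate (d (n + 1)) * w (n + 1) := hw.balance n
  rw [← h, zero_mul] at h1
  exact (mul_pos hR.lam_pos (hw.pos n (Nat.le_of_lt_succ hn))).ne' h1

/-- If some policy has a positive service rate, there is a first nonempty group. -/
theorem exists_first_group (hd : Q.IsEfficient d) (hmu : ∀ k, 0 < Q.mu k) {n : ℕ}
    (hn : 0 < Q.serviceRate (d n)) : ∃ k, 0 < Q.M k ∧ ∀ l, 0 < Q.M l → k ≤ l := by
  have hne : (Finset.univ.filter fun k => 0 < Q.M k).Nonempty := by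
    by_contra hcon
    rw [Finset.not_nonempty_iff_eq_empty, Finset.filter_eq_empty_iff] at hcon
    refine hn.ne' ((serviceRate_eq_zero_iff hmu _).2 fun k => ?_)
    have h1 := (hd n).1 k
    have h2 := hcon (Finset.mem_univ k)
    omega
  obtain ⟨k, hk, hmin⟩ := Finset.exists_min_image _ (fun k => k) hne
  refine ⟨k, (Finset.mem_filter.1 hk).2, fun l hl => hmin l ?_⟩
  exact Finset.mem_filter.2 ⟨Finset.mem_univ l, hl⟩

theorem cheapest_mul_serviceRate_le (hd : Q.IsEfficient d) (hmu : ∀ k, 0 < Q.mu k) {k : Fin K}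
    (hk : ∀ l, 0 < Q.M l → Q.c k / Q.mu k ≤ Q.c l / Q.mu l) (n : ℕ) :
    Q.h n + Q.c k / Q.mu k * Q.serviceRate (d n) ≤ Q.costRate n (d n) := by
  unfold costRate serviceRate
  rw [Finset.mul_sum]
  refine add_le_add le_rfl (Finset.sum_le_sum fun l _ => ?_)
  rcases Nat.eq_zero_or_pos (d n l) with h | h
  · simp [h]
  · have h1 := hk l (h.trans_le ((hd n).1 l))
    rw [le_div_iff₀ (hmu l)] at h1
    calc Q.c k / Q.mu k * (d n l * Q.mu l) = d n l * (Q.c k / Q.mu k * Q.mu l) := by ring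
      _ ≤ d n l * Q.c l := mul_le_mul_of_nonneg_left h1 (Nat.cast_nonneg _)

/-- All work has to be paid for at least at the cheapest rate, and holding costs are strictly
larger than in the lowest recurrent state. -/
theorem holding_add_work_lt (hd : Q.IsEfficient d) (hmu : ∀ k, 0 < Q.mu k)
    (h_mono : Monotone Q.h) (h_top : Tendsto Q.h atTop atTop)
    (hR : Rates Q.lam Q.unifRate (fun n => Q.serviceRate (d n)))
    (hw : IsWeight Q.lam (fun n => Q.serviceRate (d n)) b w)
    (hs : HasSum (fun n => w n * (Q.costRate n (d n) - η)) 0) {k : Fin K}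
    (hk : ∀ l, 0 < Q.M l → Q.c k / Q.mu k ≤ Q.c l / Q.mu l) :
    Q.h b + Q.lam * (Q.c k / Q.mu k) < η := by
  have hW := hw.tsum_pos
  have h1 := ((hasSum_costRate_of_hasSum_sub hw hs).sub
    ((hasSum_mul_serviceRate hR hw).mul_left (Q.c k / Q.mu k))).sub
    (hw.summable.hasSum.mul_left (Q.h b))
  have hterm : ∀ n, w n * (Q.h n - Q.h b)
      ≤ w n * Q.costRate n (d n) - Q.c k / Q.mu k * (w n * Q.serviceRate (d n)) - Q.h b * w n := by
    intro n
    have h2 := mul_le_mul_of_nonneg_left (cheapest_mul_serviceRate_le hd hmu hk n) (hw.nonneg n)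
    linarith
  have hnn : ∀ n, 0 ≤ w n * (Q.h n - Q.h b) := by
    intro n
    rcases lt_or_ge n b with h | h
    · rw [hw.zero n h, zero_mul]
    · exact mul_nonneg (hw.nonneg n) (sub_nonneg.2 (h_mono h))
  obtain ⟨N, hN, hbN⟩ := ((h_top.eventually_gt_atTop (Q.h b)).and (eventually_ge_atTop b)).exists
  have hpos := h1.summable.tsum_pos (fun n => (hnn n).trans (hterm n)) N
    ((mul_pos (hw.pos N hbN) (sub_pos.2 hN)).trans_le (hterm N))
  rw [h1.tsum_eq] at hpos
  have h3 : 0 < (η - Q.lam * (Q.c k / Q.mu k) - Q.h b) * ∑' n, w n := by linarith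
  have h4 := pos_of_mul_pos_left h3 hW.le
  linarith

namespace IsOptimal

variable (hlam : 0 < Q.lam) (hmu : ∀ k, 0 < Q.mu k) (hd : Q.IsOptimal d η)
include hlam hmu hd

/-- No reversible weight of another policy has a smaller average cost. -/
theorem nonneg_of_hasSum {d' : ℕ → Fin K → ℕ} (hd' : Q.IsEfficient d') {w' : ℕ → ℝ} {s : ℝ}
    (hw' : IsWeight Q.lam (fun n => Q.serviceRate (d' n)) b w')
    (hs : HasSum (fun n => w' n * (Q.costRate n (d' n) - η)) s) : 0 ≤ s := by
  have h1 := hd.2.2 d' hd' b _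
    (hasAverageCost_of_weight (hd'.rates hlam hmu) hw' hs le_rfl)
  have h2 : 0 ≤ s / ∑' n, w' n := by linarith
  have h3 := mul_nonneg h2 hw'.tsum_pos.le
  rwa [div_mul_cancel₀ _ hw'.tsum_pos.ne'] at h3

variable (hc : ∀ k, 0 ≤ Q.c k) (h_mono : Monotone Q.h) (h_top : Tendsto Q.h atTop atTop)
include hc h_mono h_top

/-- From the bottom of the weight, the average cost is the ratio of `∑ w f` to `∑ w`. An optimal
policy has cost `η` from that state too. -/
theorem exists_weight_of_bottom :
    ∃ b w, IsWeight Q.lam (fun n => Q.serviceRate (d n)) b w ∧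
      HasSum (fun n => w n * (Q.costRate n (d n) - η)) 0 := by
  have hR := hd.1.rates hlam hmu
  obtain ⟨b, w, hw, hsum⟩ := (hd.2.1 0).exists_weight hR hc h_mono h_top
  refine ⟨b, w, hw, ?_⟩
  have h1 : Summable fun n => w n * (Q.costRate n (d n) - η) :=
    (hsum.sub (hw.summable.mul_right η)).congr fun n => by ring
  have h2 := (hd.2.1 b).unique (hasAverageCost_of_weight hR hw h1.hasSum le_rfl)
  have h3 : (∑' n, w n * (Q.costRate n (d n) - η)) / ∑' n, w n = 0 := by linarith
  rcases div_eq_zero_iff.1 h3 with h | h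
  · rw [← h]; exact h1.hasSum
  · exact absurd h hw.tsum_pos.ne'

omit hc in
/-- Serving one more customer with a cheapest server in a recurrent state without service reduces
the cost, so that the lowest recurrent state is `0`. -/
theorem bottom_eq_zero (h_sorted : Monotone fun k => Q.c k / Q.mu k)
    (hw : IsWeight Q.lam (fun n => Q.serviceRate (d n)) b w)
    (hs : HasSum (fun n => w n * (Q.costRate n (d n) - η)) 0) : b = 0 := by
  have hR := hd.1.rates hlam hmu
  rcases b with _ | a
  · rfl
  exfalso
  obtain ⟨k, hkM, hk⟩ := exists_first_group hd.1 hmu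
    (serviceRate_pos_of_weight hR hw (Nat.lt_succ_self (a + 1)))
  have hlt := holding_add_work_lt hd.1 hmu h_mono h_top hR hw hs
    fun l hl => h_sorted (hk l hl)
  have hdb : ∀ l, d (a + 1) l = 0 := (serviceRate_eq_zero_iff hmu _).1 (hw.mu_bottom hR)
  have hwb := hw.pos (a + 1) le_rfl
  -- One server of the cheapest nonempty group is switched on in the idle bottom state `a + 1`, and
  -- all service is off up to `a`, so that `a` becomes the new bottom.
  set d' : ℕ → Fin K → ℕ := fun n =>
    if n ≤ a then 0 else if n = a + 1 then Pi.single k 1 else d n with hd'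
  have hlow : ∀ n, n ≤ a → d' n = 0 := fun n hn => if_pos hn
  have hmid : d' (a + 1) = Pi.single k 1 := by simp [hd']
  have hhigh : ∀ n, a + 1 < n → d' n = d n := fun n hn => by
    have h1 : ¬ n ≤ a := by omega
    have h2 : n ≠ a + 1 := by omega
    simp [hd', h1, h2]
  have hs1 : Q.serviceRate (Pi.single k 1) = Q.mu k := by
    unfold serviceRate
    rw [Finset.sum_eq_single k] <;> simp +contextual
  have hs0 : Q.serviceRate 0 = 0 := by simp [serviceRate]
  have hc1 : Q.costRate (a + 1) (Pi.single k 1) = Q.costRate (a + 1) (d (a + 1)) + Q.c k := by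
    unfold costRate
    rw [Finset.sum_eq_single k] <;> simp +contextual [hdb]
  have hc0 : Q.costRate a 0 = Q.h a := by simp [costRate]
  have heff : Q.IsEfficient d' := by
    intro n
    rcases lt_trichotomy n (a + 1) with h | rfl | h
    · rw [hlow n (Nat.le_of_lt_succ h)]; simp
    · rw [hmid]
      refine ⟨fun l => ?_, ?_⟩
      · rcases eq_or_ne l k with rfl | hl
        · rw [Pi.single_eq_same]; exact hkM
        · simp [hl]
      · rw [Finset.sum_eq_single k] <;> simp +contextual
    · rw [hhigh n h]; exact hd.1 n
  -- The mass at `a` that balances the new edge: `lam * A = mu k * w (a + 1)`.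
  set A : ℝ := Q.mu k * w (a + 1) / Q.lam with hA
  have hA0 : 0 < A := by have := hmu k; positivity
  set w' : ℕ → ℝ := fun n => w n + if n = a then A else 0 with hw'
  have hw'low : ∀ n, n < a → w' n = 0 := fun n hn => by
    simp [hw', hn.ne, hw.zero n (by omega)]
  have hw'mid : w' a = A := by simp [hw', hw.zero a]
  have hw'high : ∀ n, a < n → w' n = w n := fun n hn => by simp [hw', hn.ne']
  have hweight : IsWeight Q.lam (fun n => Q.serviceRate (d' n)) a w' := by
    refine ⟨fun n hn => ?_, hw'low, fun n => ?_, ?_⟩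
    · rcases hn.eq_or_lt with rfl | h
      · rw [hw'mid]; exact hA0
      · rw [hw'high n h]; exact hw.pos n h
    · rcases lt_trichotomy n a with h | rfl | h
      · simp only [hw'low n h, hlow (n + 1) h, hs0, mul_zero, zero_mul]
      · simp only [hw'mid, hw'high (n + 1) (Nat.lt_succ_self n), hmid, hs1, hA]
        field_simp
      · simp only [hw'high n h, hw'high (n + 1) (by omega), hhigh (n + 1) (by omega)]
        exact hw.balance n
    · exact hw.summable.add (hasSum_ite_eq a A).summable
  have hsum : HasSum (fun n => w' n * (Q.costRate n (d' n) - η))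
      (0 + w (a + 1) * Q.c k + A * (Q.h a - η)) := by
    refine ((hs.add (hasSum_ite_eq (a + 1) (w (a + 1) * Q.c k))).add
      (hasSum_ite_eq a (A * (Q.h a - η)))).congr_fun fun n => ?_
    rcases lt_trichotomy n a with h | rfl | h
    · have h1 : n ≠ a + 1 := by omega
      simp [hw'low n h, hw.zero n (by omega), h1, h.ne]
    · simp [hw'mid, hlow n le_rfl, hc0, hw.zero n (Nat.lt_succ_self n)]
    · rcases eq_or_lt_of_le (Nat.succ_le_of_lt h) with rfl | h'
      · simp only [Nat.succ_eq_add_one, hw'high (a + 1) (Nat.lt_succ_self a), hmid, hc1, if_true,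
          Nat.succ_ne_self, if_false]
        ring
      · have h1 : n ≠ a + 1 := by omega
        simp [hw'high n h, hhigh n h', h1, h.ne']
  have hge := hd.nonneg_of_hasSum hlam hmu heff hweight hsum
  -- Optimality makes this total nonnegative, so `η ≤ h a + lam * (c k / mu k)`, against the strict
  -- bound `hlt` and `h a ≤ h (a + 1)`.
  have hid : 0 + w (a + 1) * Q.c k + A * (Q.h a - η)
      = A * (Q.h a + Q.lam * (Q.c k / Q.mu k) - η) := by
    have := (hmu k).ne'
    simp only [hA]
    field_simp
    ring
  rw [hid] at hge
  have h5 := nonneg_of_mul_nonneg_right hge hA0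
  linarith [h_mono (Nat.le_succ a)]

theorem exists_weight (h_sorted : Monotone fun k => Q.c k / Q.mu k) :
    ∃ w, IsWeight Q.lam (fun n => Q.serviceRate (d n)) 0 w ∧
    HasSum (fun n => w n * (Q.costRate n (d n) - η)) 0 := by
  obtain ⟨b, w, hw, hs⟩ := hd.exists_weight_of_bottom hlam hmu hc h_mono h_top
  obtain rfl := hd.bottom_eq_zero hlam hmu h_mono h_top h_sorted hw hs
  exact ⟨w, hw, hs⟩

omit hc h_mono h_top in
/-- The optimality inequality: the policy minimizes the cost rate net of the value of service. -/
theorem bellman (hw : IsWeight Q.lam (fun n => Q.serviceRate (d n)) 0 w)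
    (hs : HasSum (fun n => w n * (Q.costRate n (d n) - η)) 0) {G : ℕ → ℝ}
    (hG : ∀ n, Q.lam * G (n + 1) = Q.serviceRate (d n) * G n + η - Q.costRate n (d n))
    {n : ℕ} (hn : 1 ≤ n) {m : Fin K → ℕ} (hm : ∀ k, m k ≤ Q.M k) (hmn : ∑ k, m k ≤ n) :
    Q.costRate n (d n) - Q.serviceRate (d n) * G n
      ≤ Q.costRate n m - Q.serviceRate m * G n := by
  have hR := hd.1.rates hlam hmu
  obtain ⟨n, rfl⟩ := Nat.exists_eq_succ_of_ne_zero (Nat.one_le_iff_ne_zero.1 hn)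
  simp only [Nat.succ_eq_add_one] at *
  set μ := Q.serviceRate (d (n + 1)) with hμ
  set μ' := Q.serviceRate m with hμ'
  have hμ0 : 0 < μ := serviceRate_pos_of_weight hR hw (Nat.succ_pos n)
  have hμ'0 : 0 ≤ μ' := serviceRate_nonneg hmu m
  set d' : ℕ → Fin K → ℕ := Function.update d (n + 1) m with hd'
  have hsame : d' (n + 1) = m := Function.update_self _ _ _
  have hne : ∀ i, i ≠ n + 1 → d' i = d i := fun i hi => Function.update_of_ne hi _ _
  have heff : Q.IsEfficient d' := by
    intro i
    rcases eq_or_ne i (n + 1) with rfl | hi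
    · rw [hsame]; exact ⟨hm, hmn⟩
    · rw [hne i hi]; exact hd.1 i
  -- Only the edge into state `n + 1` changes its death rate, from `μ` to `μ'`. Scaling by `μ'`
  -- below it and by `μ` above it restores balance without dividing by `μ'`; if `μ' = 0`, the bottom
  -- moves up to `n + 1`.
  set w' : ℕ → ℝ := fun i => (if i ≤ n then μ' else μ) * w i with hw'
  have hlow : ∀ i, i ≤ n → w' i = μ' * w i := fun i hi => by simp [hw', hi]
  have hhigh : ∀ i, n < i → w' i = μ * w i := fun i hi => by simp [hw', not_le.2 hi]
  have hbal : ∀ i, Q.lam * w' i = Q.serviceRate (d' (i + 1)) * w' (i + 1) := by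
    intro i
    have h0 : Q.lam * w i = Q.serviceRate (d (i + 1)) * w (i + 1) := hw.balance i
    rcases lt_trichotomy i n with h | rfl | h
    · rw [hlow i h.le, hlow (i + 1) h, hne (i + 1) (by omega)]
      linear_combination μ' * h0
    · rw [hlow i le_rfl, hhigh (i + 1) (Nat.lt_succ_self i), hsame]
      linear_combination μ' * h0
    · rw [hhigh i h, hhigh (i + 1) (by omega), hne (i + 1) (by omega)]
      linear_combination μ * h0
  have hsw : Summable w' := by
    refine Summable.of_norm_bounded (hw.summable.mul_left (μ' + μ)) fun i => ?_
    rw [Real.norm_eq_abs, hw', abs_mul, abs_of_nonneg (hw.nonneg i)]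
    refine mul_le_mul_of_nonneg_right ?_ (hw.nonneg i)
    split_ifs
    · rw [abs_of_nonneg hμ'0]; linarith
    · rw [abs_of_pos hμ0]; linarith
  have hweight : ∃ b, IsWeight Q.lam (fun i => Q.serviceRate (d' i)) b w' := by
    rcases hμ'0.eq_or_lt with h0 | h0
    · refine ⟨n + 1, fun i hi => ?_, fun i hi => ?_, hbal, hsw⟩
      · rw [hhigh i hi]; exact mul_pos hμ0 (hw.pos i (Nat.zero_le i))
      · rw [hlow i (Nat.le_of_lt_succ hi), ← h0, zero_mul]
    · refine ⟨0, fun i _ => ?_, fun i hi => absurd hi (Nat.not_lt_zero i), hbal, hsw⟩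
      refine mul_pos ?_ (hw.pos i (Nat.zero_le i))
      split_ifs <;> assumption
  obtain ⟨b, hweight⟩ := hweight
  have hfin : HasSum (fun i => if i ≤ n then w i * (Q.costRate i (d i) - η) else 0)
      (-(Q.lam * w n * G (n + 1))) := by
    rw [← sum_weight_mul_excess hR.mu_zero hw.balance hG n]
    have h : HasSum (fun i => if i ≤ n then w i * (Q.costRate i (d i) - η) else 0)
        (∑ i ∈ Finset.range (n + 1), if i ≤ n then w i * (Q.costRate i (d i) - η) else 0) := by
      refine hasSum_sum_of_ne_finset_zero fun i hi => if_neg ?_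
      rwa [Finset.mem_range, Nat.lt_succ_iff] at hi
    convert! h using 1
    exact Finset.sum_congr rfl fun i hi => (if_pos (Nat.le_of_lt_succ (Finset.mem_range.1 hi))).symm
  -- The new excess is `μ` times the old total, which is zero, plus `μ' - μ` times the part up to
  -- `n`, which is known through `G`, plus the changed cost in state `n + 1`.
  have hsum := ((hs.mul_left μ).add (hfin.mul_left (μ' - μ))).add
    (hasSum_ite_eq (n + 1)
      (μ * w (n + 1) * (Q.costRate (n + 1) m - Q.costRate (n + 1) (d (n + 1)))))
  have hge := hd.nonneg_of_hasSum hlam hmu heff hweight (hsum.congr_fun fun i => ?_)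
  · have h1 : Q.lam * w n = Q.serviceRate (d (n + 1)) * w (n + 1) := hw.balance n
    rw [h1, ← hμ] at hge
    have h2 : 0 ≤ μ * w (n + 1) * ((Q.costRate (n + 1) m - μ' * G (n + 1))
        - (Q.costRate (n + 1) (d (n + 1)) - μ * G (n + 1))) := by linarith
    have h3 := nonneg_of_mul_nonneg_right h2 (mul_pos hμ0 (hw.pos (n + 1) (Nat.zero_le _)))
    linarith
  · rcases lt_trichotomy i (n + 1) with h | rfl | h
    · rw [hlow i (Nat.le_of_lt_succ h), hne i h.ne, if_pos (Nat.le_of_lt_succ h), if_neg h.ne]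
      ring
    · rw [hhigh _ (Nat.lt_succ_self n), hsame, if_neg (by omega), if_pos rfl]
      ring
    · rw [hhigh i (by omega), hne i h.ne', if_neg (by omega), if_neg h.ne']
      ring

omit hc h_mono h_top in
/-- A policy that differs from an optimal one in finitely many states and satisfies the same
Poisson equation is optimal. -/
theorem of_same_potential (hw : IsWeight Q.lam (fun n => Q.serviceRate (d n)) 0 w)
    (hs : HasSum (fun n => w n * (Q.costRate n (d n) - η)) 0) {G : ℕ → ℝ}
    (hG : ∀ n, Q.lam * G (n + 1) = Q.serviceRate (d n) * G n + η - Q.costRate n (d n))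
    {d' : ℕ → Fin K → ℕ} (hd' : Q.IsEfficient d') (hpos : ∀ n, 0 < Q.serviceRate (d' (n + 1)))
    (hG' : ∀ n, Q.lam * G (n + 1) = Q.serviceRate (d' n) * G n + η - Q.costRate n (d' n))
    {N : ℕ} (hN : ∀ n, N ≤ n → d' n = d n) : Q.IsOptimal d' η := by
  have hR := hd.1.rates hlam hmu
  have hR' := hd'.rates hlam hmu
  set w' : ℕ → ℝ := fun n => ∏ i ∈ Finset.range n, Q.lam / Q.serviceRate (d' (i + 1)) with hw'
  have hw'pos : ∀ n, 0 < w' n := fun n => Finset.prod_pos fun i _ => div_pos hlam (hpos i)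
  have hbal : ∀ n, Q.lam * w' n = Q.serviceRate (d' (n + 1)) * w' (n + 1) := by
    intro n
    simp only [hw', Finset.prod_range_succ]
    field_simp [(hpos n).ne']
  have hwN : 0 < w N := hw.pos N (Nat.zero_le N)
  set κ : ℝ := w' N / w N with hκ
  have hprop : ∀ n, N ≤ n → w' n = κ * w n := by
    intro n hn
    induction n, hn using Nat.le_induction with
    | base => rw [hκ, div_mul_cancel₀ _ hwN.ne']
    | succ n hn ih =>
      have h1 := hbal n
      have h2 : Q.lam * w n = Q.serviceRate (d (n + 1)) * w (n + 1) := hw.balance n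
      have h3 := hpos n
      rw [hN (n + 1) (by omega)] at h1 h3
      refine mul_left_cancel₀ h3.ne' ?_
      rw [← h1, ih]
      linear_combination κ * h2
  have hsum : ∀ u u' : ℕ → ℝ, (∀ n, N ≤ n → u' n = κ * u n) → Summable u → Summable u' := by
    intro u u' huu hu
    rw [← summable_nat_add_iff N]
    exact (((summable_nat_add_iff N).2 hu).mul_left κ).congr
      fun n => (huu (n + N) (Nat.le_add_left N n)).symm
  have hweight : IsWeight Q.lam (fun n => Q.serviceRate (d' n)) 0 w' :=
    ⟨fun n _ => hw'pos n, fun n hn => absurd hn (Nat.not_lt_zero n), hbal,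
      hsum w w' hprop hw.summable⟩
  have hs' : Summable fun n => w' n * (Q.costRate n (d' n) - η) :=
    hsum _ _ (fun n hn => by rw [hprop n hn, hN n hn, mul_assoc]) hs.summable
  -- From `N` on, the partial sums for both policies are `-(lam * w * G)` with the same `G` and
  -- proportional weights. So those for `d'` are `κ` times those for `d`, which tend to zero.
  have hzero : ∑' n, w' n * (Q.costRate n (d' n) - η) = 0 := by
    have h1 := hs'.hasSum.tendsto_sum_nat.comp (tendsto_add_atTop_nat 1)
    have h2 := (hs.tendsto_sum_nat.comp (tendsto_add_atTop_nat 1)).const_mul κ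
    rw [mul_zero] at h2
    refine tendsto_nhds_unique_of_eventuallyEq h1 h2 ?_
    filter_upwards [eventually_ge_atTop N] with n hn
    simp only [Function.comp]
    rw [sum_weight_mul_excess hR'.mu_zero hbal hG', sum_weight_mul_excess hR.mu_zero hw.balance hG,
      hprop n hn]
    ring
  have h0 := hs'.hasSum
  rw [hzero] at h0
  refine ⟨hd', fun n => ?_, hd.2.2⟩
  have h := hasAverageCost_of_weight hR' hweight h0 (Nat.zero_le n)
  rwa [zero_div, add_zero] at h

end IsOptimal

/-! ### Greedy allocation -/

/-- Add the groups in increasing order: the last one takes what the earlier ones leave of the `n`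
customers. -/
theorem sum_min_sub {ι : Type*} [LinearOrder ι] (M : ι → ℕ) (n : ℕ) (s : Finset ι) :
    ∑ l ∈ s, min (M l) (n - ∑ i ∈ s with i < l, M i) = min (∑ l ∈ s, M l) n := by
  induction s using Finset.induction_on_max with
  | empty => simp
  | insert a s ha ih =>
    have hnot : a ∉ s := fun h => lt_irrefl a (ha a h)
    have h1 : (insert a s).filter (· < a) = s := by
      ext i
      simp only [Finset.mem_filter, Finset.mem_insert]
      refine ⟨fun ⟨h, h'⟩ => h.resolve_left h'.ne, fun h => ⟨Or.inr h, ha i h⟩⟩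
    have h2 : ∀ l ∈ s, (insert a s).filter (· < l) = s.filter (· < l) := by
      intro l hl
      rw [Finset.filter_insert, if_neg (ha l hl).not_gt]
    have h3 : ∑ l ∈ s, min (M l) (n - ∑ i ∈ insert a s with i < l, M i)
        = ∑ l ∈ s, min (M l) (n - ∑ i ∈ s with i < l, M i) :=
      Finset.sum_congr rfl fun l hl => by rw [h2 l hl]
    rw [Finset.sum_insert hnot, Finset.sum_insert hnot, h1, h3, ih]
    omega

/-- The allocation of `n` customers to servers by priority of the groups. -/
def greedy (Q : GroupServerQueue K) (n : ℕ) (k : Fin K) : ℕ :=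
  min (Q.M k) (n - ∑ l ∈ Finset.Iio k, Q.M l)

theorem sum_greedy_of_isLowerSet (n : ℕ) (s : Finset (Fin K))
    (hs : ∀ k ∈ s, ∀ l, l < k → l ∈ s) :
    ∑ l ∈ s, Q.greedy n l = min (∑ l ∈ s, Q.M l) n := by
  rw [← sum_min_sub]
  refine Finset.sum_congr rfl fun l hl => ?_
  have h : Finset.Iio l = s.filter (· < l) := by
    ext i
    simp only [Finset.mem_Iio, Finset.mem_filter]
    exact ⟨fun hi => ⟨hs l hl i hi, hi⟩, fun hi => hi.2⟩
  rw [greedy, h]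

theorem sum_Iio_greedy (n : ℕ) (k : Fin K) :
    ∑ l ∈ Finset.Iio k, Q.greedy n l = min (∑ l ∈ Finset.Iio k, Q.M l) n :=
  sum_greedy_of_isLowerSet n _ fun _ hi _ hl =>
    Finset.mem_Iio.2 (hl.trans (Finset.mem_Iio.1 hi))

theorem sum_Iic_greedy (n : ℕ) (k : Fin K) :
    ∑ l ∈ Finset.Iic k, Q.greedy n l = min (∑ l ∈ Finset.Iic k, Q.M l) n :=
  sum_greedy_of_isLowerSet n _ fun _ hi _ hl =>
    Finset.mem_Iic.2 (hl.le.trans (Finset.mem_Iic.1 hi))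

/-- `greedy` subtracts full group sizes where `maxOn` subtracts busy servers. The two agree because
earlier groups use the minimum of their total size and `n`, and subtraction is truncated at zero. -/
theorem maxOn_eq_greedy {n : ℕ} {k : Fin K} (h : ∀ l, l < k → d n l = Q.greedy n l) :
    Q.maxOn d n k = Q.greedy n k := by
  unfold maxOn
  rw [Finset.sum_congr rfl fun l hl => h l (Finset.mem_Iio.1 hl), sum_Iio_greedy, greedy]
  omega

theorem eq_greedy_of_eq_maxOn {n : ℕ} {k : Fin K} (h : ∀ l, l ≤ k → d n l = Q.maxOn d n l) :
    d n k = Q.greedy n k := by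
  induction k using WellFoundedLT.induction with
  | ind k ih =>
    rw [h k le_rfl]
    exact maxOn_eq_greedy fun l hl => ih l hl fun i hi => h i (hi.trans hl.le)

theorem greedy_mono (k : Fin K) : Monotone fun n => Q.greedy n k := fun _ _ h =>
  min_le_min le_rfl (Nat.sub_le_sub_right h _)

theorem greedy_zero (k : Fin K) : Q.greedy 0 k = 0 := by simp [greedy]

theorem sum_Iic_eq (f : Fin K → ℕ) (k : Fin K) :
    ∑ l ∈ Finset.Iic k, f l = f k + ∑ l ∈ Finset.Iio k, f l := by
  have h : Finset.Iic k = insert k (Finset.Iio k) := by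
    ext i; simp [le_iff_eq_or_lt]
  rw [h, Finset.sum_insert (by simp)]

theorem sum_Iic_le_sum_Iio (f : Fin K → ℕ) {k l : Fin K} (h : k < l) :
    ∑ i ∈ Finset.Iic k, f i ≤ ∑ i ∈ Finset.Iio l, f i :=
  Finset.sum_le_sum_of_subset fun _ hi => Finset.mem_Iio.2 ((Finset.mem_Iic.1 hi).trans_lt h)

/-- Greedy sums of decreasing values are concave in the number of customers. -/
theorem greedy_concave {u : Fin K → ℝ} (hu0 : ∀ k, 0 ≤ u k) (hu : Antitone u) (n : ℕ) :
    ∑ k, ((Q.greedy (n + 2) k : ℝ) - Q.greedy (n + 1) k) * u k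
      ≤ ∑ k, ((Q.greedy (n + 1) k : ℝ) - Q.greedy n k) * u k := by
  have hnn : ∀ n k, 0 ≤ (Q.greedy (n + 1) k : ℝ) - Q.greedy n k := fun n k =>
    sub_nonneg.2 (Nat.cast_le.2 (greedy_mono k (Nat.le_succ n)))
  by_cases hex : ∃ k, Q.greedy (n + 2) k ≠ Q.greedy (n + 1) k
  · obtain ⟨k, hk⟩ := hex
    -- Customer `n + 2` joins group `k`. Customer `n + 1` was therefore placed in some group up to
    -- `k`, whose value is at least `u k`.
    have hk1 : ∑ l ∈ Finset.Iio k, Q.M l ≤ n + 1 ∧ n + 1 < ∑ l ∈ Finset.Iic k, Q.M l := by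
      rw [sum_Iic_eq]
      unfold greedy at hk
      omega
    have hother : ∀ l, l ≠ k → Q.greedy (n + 2) l = Q.greedy (n + 1) l := by
      intro l hl
      have e1 := sum_Iic_eq Q.M l
      unfold greedy
      rcases lt_or_gt_of_ne hl with h | h
      · have := sum_Iic_le_sum_Iio Q.M h
        omega
      · have := sum_Iic_le_sum_Iio Q.M h
        omega
    have hone : Q.greedy (n + 2) k ≤ Q.greedy (n + 1) k + 1 := by
      unfold greedy; omega
    have h1 : ∑ i, ((Q.greedy (n + 2) i : ℝ) - Q.greedy (n + 1) i) * u i ≤ u k := by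
      rw [Finset.sum_eq_single k]
      · have : (Q.greedy (n + 2) k : ℝ) ≤ Q.greedy (n + 1) k + 1 := by exact_mod_cast hone
        exact mul_le_of_le_one_left (hu0 k) (by linarith)
      · intro l _ hl
        rw [hother l hl, sub_self, zero_mul]
      · simp
    have h2 : ∑ i ∈ Finset.Iic k, ((Q.greedy (n + 1) i : ℝ) - Q.greedy n i) = 1 := by
      rw [Finset.sum_sub_distrib, ← Nat.cast_sum, ← Nat.cast_sum, sum_Iic_greedy, sum_Iic_greedy,
        min_eq_right hk1.2.le, min_eq_right (by omega)]
      push_cast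
      ring
    calc ∑ i, ((Q.greedy (n + 2) i : ℝ) - Q.greedy (n + 1) i) * u i ≤ u k := h1
      _ = ∑ i ∈ Finset.Iic k, ((Q.greedy (n + 1) i : ℝ) - Q.greedy n i) * u k := by
          rw [← Finset.sum_mul, h2, one_mul]
      _ ≤ ∑ i ∈ Finset.Iic k, ((Q.greedy (n + 1) i : ℝ) - Q.greedy n i) * u i :=
          Finset.sum_le_sum fun i hi =>
            mul_le_mul_of_nonneg_left (hu (Finset.mem_Iic.1 hi)) (hnn n i)
      _ ≤ ∑ i, ((Q.greedy (n + 1) i : ℝ) - Q.greedy n i) * u i :=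
          Finset.sum_le_sum_of_subset_of_nonneg (Finset.subset_univ _)
            fun i _ _ => mul_nonneg (hnn n i) (hu0 i)
  · push Not at hex
    simp only [hex, sub_self, zero_mul, Finset.sum_const_zero]
    exact Finset.sum_nonneg fun i _ => mul_nonneg (hnn n i) (hu0 i)

/-! ### The value of service -/

/-- The value of a server of group `k` when the service of a customer is worth `x`. -/
def serverValue (Q : GroupServerQueue K) (x : ℝ) (k : Fin K) : ℝ := Q.mu k * x - Q.c k

/-- The largest value of service in state `n` when the service of a customer is worth `x`. -/
noncomputable def serviceValue (Q : GroupServerQueue K) (n : ℕ) (x : ℝ) : ℝ :=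
  ∑ k, (Q.greedy n k : ℝ) * max 0 (Q.serverValue x k)

theorem serviceRate_mul_sub_costRate (n : ℕ) (m : Fin K → ℕ) (x : ℝ) :
    Q.serviceRate m * x - Q.costRate n m = ∑ k, (m k : ℝ) * Q.serverValue x k - Q.h n := by
  have h : ∑ k, (m k : ℝ) * Q.serverValue x k
      = (∑ k, (m k : ℝ) * Q.mu k) * x - ∑ k, (m k : ℝ) * Q.c k := by
    rw [Finset.sum_mul, ← Finset.sum_sub_distrib]
    exact Finset.sum_congr rfl fun k _ => by unfold serverValue; ring
  rw [h]
  unfold serviceRate costRate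
  ring

section ServerValue

variable (hmu : ∀ k, 0 < Q.mu k)
include hmu

theorem serverValue_mono (k : Fin K) : Monotone fun x => Q.serverValue x k := fun _ _ h =>
  sub_le_sub_right (mul_le_mul_of_nonneg_left h (hmu k).le) _

theorem serverValue_pos_iff (x : ℝ) (k : Fin K) :
    0 < Q.serverValue x k ↔ Q.c k / Q.mu k < x := by
  rw [serverValue, sub_pos, div_lt_iff₀ (hmu k), mul_comm]

theorem serverValue_neg_iff (x : ℝ) (k : Fin K) :
    Q.serverValue x k < 0 ↔ x < Q.c k / Q.mu k := by
  rw [serverValue, sub_neg, lt_div_iff₀ (hmu k), mul_comm]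

theorem serverValue_eq (x : ℝ) (k : Fin K) :
    Q.serverValue x k = Q.mu k * (x - Q.c k / Q.mu k) := by
  have := (hmu k).ne'
  unfold serverValue
  field_simp

theorem serviceValue_mono (n : ℕ) : Monotone (Q.serviceValue n) := fun _ _ h =>
  Finset.sum_le_sum fun k _ => mul_le_mul_of_nonneg_left
    (max_le_max le_rfl (serverValue_mono hmu k h)) (Nat.cast_nonneg _)

theorem serviceValue_diff_mono (n : ℕ) :
    Monotone fun x => Q.serviceValue (n + 1) x - Q.serviceValue n x := by
  intro x y h
  simp only [serviceValue, ← Finset.sum_sub_distrib, ← sub_mul]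
  exact Finset.sum_le_sum fun k _ => mul_le_mul_of_nonneg_left
    (max_le_max le_rfl (serverValue_mono hmu k h))
    (sub_nonneg.2 (Nat.cast_le.2 (greedy_mono k (Nat.le_succ n))))

variable (h_sorted : Monotone fun k => Q.c k / Q.mu k) (h_scale : Antitone Q.mu)
include h_sorted h_scale

/-- Scale economies make `mu k * (x - c k / mu k)` a product of two factors decreasing in `k` where
it is positive. Successive customers thus get servers of decreasing value. -/
theorem serviceValue_concave (n : ℕ) (x : ℝ) :
    Q.serviceValue (n + 2) x - Q.serviceValue (n + 1) x
      ≤ Q.serviceValue (n + 1) x - Q.serviceValue n x := by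
  simp only [serviceValue, ← Finset.sum_sub_distrib, ← sub_mul]
  refine greedy_concave (fun k => le_max_left _ _) (fun k l hkl => max_le (le_max_left _ _) ?_) n
  rcases le_or_gt (Q.serverValue x l) 0 with h | h
  · exact h.trans (le_max_left _ _)
  · refine le_trans ?_ (le_max_right _ _)
    have h1 := (serverValue_pos_iff hmu x l).1 h
    have h2 : Q.c k / Q.mu k ≤ Q.c l / Q.mu l := h_sorted hkl
    rw [serverValue_eq hmu, serverValue_eq hmu]
    exact mul_le_mul (h_scale hkl) (by linarith) (by linarith) (hmu k).le

/-- Heterogeneity makes one of the two factors strictly smaller: equal rates and equal ratios would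
force equal costs. -/
theorem serverValue_lt (h_het : ∀ k l, k ≠ l → ¬(Q.c k = Q.c l ∧ Q.mu k = Q.mu l))
    {x : ℝ} {k l : Fin K} (hkl : k < l) (hk : 0 < Q.serverValue x k) :
    Q.serverValue x l < Q.serverValue x k := by
  rcases le_or_gt (Q.serverValue x l) 0 with h | h
  · exact h.trans_lt hk
  have h1 := (serverValue_pos_iff hmu x l).1 h
  have h2 : Q.c k / Q.mu k ≤ Q.c l / Q.mu l := h_sorted hkl.le
  have h3 : Q.mu l ≤ Q.mu k := h_scale hkl.le
  rw [serverValue_eq hmu, serverValue_eq hmu]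
  rcases h3.eq_or_lt with h4 | h4
  · rcases h2.eq_or_lt with h5 | h5
    · refine absurd ⟨?_, h4.symm⟩ (h_het k l hkl.ne)
      rw [h4] at h5
      exact (div_left_inj' (hmu k).ne').1 h5
    · rw [← h4] at h5 ⊢
      exact mul_lt_mul_of_pos_left (by linarith) (hmu l)
  · calc Q.mu l * (x - Q.c l / Q.mu l) < Q.mu k * (x - Q.c l / Q.mu l) :=
          mul_lt_mul_of_pos_right h4 (by linarith)
      _ ≤ Q.mu k * (x - Q.c k / Q.mu k) := mul_le_mul_of_nonneg_left (by linarith) (hmu k).le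

end ServerValue

/-! ### Exchange arguments for maximizers -/

/-- A maximizer of a linear value fills a group that is strictly better than all later ones. -/
theorem eq_min_of_isMax {M m : Fin K → ℕ} {n : ℕ} {v : Fin K → ℝ} (hm : ∀ k, m k ≤ M k)
    (hmn : ∑ k, m k ≤ n)
    (hmax : ∀ m' : Fin K → ℕ, (∀ k, m' k ≤ M k) → ∑ k, m' k ≤ n →
      ∑ k, (m' k : ℝ) * v k ≤ ∑ k, (m k : ℝ) * v k)
    {k : Fin K} (hk : 0 < v k) (hlt : ∀ l, k < l → v l < v k) :
    m k = min (M k) (n - ∑ l ∈ Finset.Iio k, m l) := by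
  have hIic : ∑ l ∈ Finset.Iic k, m l ≤ ∑ l, m l :=
    Finset.sum_le_sum_of_subset (Finset.subset_univ _)
  rw [sum_Iic_eq] at hIic
  refine le_antisymm (le_min (hm k) (by omega)) ?_
  by_contra hcon
  rw [not_le, lt_min_iff] at hcon
  -- If all customers are in service, some later group has a server on, and moving its customer to
  -- group `k` gains value. Otherwise a waiting customer is given a server of group `k`.
  rcases hmn.eq_or_lt with hn | hn
  · obtain ⟨l, hl, hml⟩ : ∃ l, k < l ∧ 0 < m l := by
      by_contra hno
      push Not at hno
      have h1 : ∑ l ∈ Finset.Iic k, m l = ∑ l, m l := by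
        refine Finset.sum_subset (Finset.subset_univ _) fun l _ hl => ?_
        have := hno l (not_le.1 fun h => hl (Finset.mem_Iic.2 h))
        omega
      rw [sum_Iic_eq] at h1
      omega
    set m' : Fin K → ℕ := fun i => if i = k then m i + 1 else if i = l then m i - 1 else m i
      with hm'
    have hsum : ∀ u : Fin K → ℝ, ∑ i, (m' i : ℝ) * u i = ∑ i, (m i : ℝ) * u i + u k - u l := by
      intro u
      have hpt : ∀ i, (m' i : ℝ) * u i
          = m i * u i + (if i = k then u k else 0) - (if i = l then u l else 0) := by
        intro i
        by_cases h1 : i = k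
        · subst h1
          simp [hm', hl.ne]
          ring
        · by_cases h2 : i = l
          · subst h2
            simp only [hm', h1, if_false, if_true]
            rw [Nat.cast_sub hml]
            push_cast
            ring
          · simp [hm', h1, h2]
      simp only [hpt, Finset.sum_sub_distrib, Finset.sum_add_distrib, Finset.sum_ite_eq',
        Finset.mem_univ, if_true]
    have h1 := hsum fun _ => 1
    simp only [mul_one, add_sub_cancel_right] at h1
    have h2 : ∑ i, m' i = ∑ i, m i := by exact_mod_cast h1
    have h3 := hmax m' (fun i => ?_) (h2.trans_le hmn)
    · rw [hsum v] at h3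
      linarith [hlt l hl]
    · have := hm i
      simp only [hm']
      split_ifs with e1 e2
      · subst e1; omega
      · omega
      · exact this
  · set m' : Fin K → ℕ := fun i => if i = k then m i + 1 else m i with hm'
    have hsum : ∀ u : Fin K → ℝ, ∑ i, (m' i : ℝ) * u i = ∑ i, (m i : ℝ) * u i + u k := by
      intro u
      have hpt : ∀ i, (m' i : ℝ) * u i = m i * u i + (if i = k then u k else 0) := by
        intro i
        by_cases h1 : i = k
        · subst h1
          simp [hm']
          ring
        · simp [hm', h1]
      simp only [hpt, Finset.sum_add_distrib, Finset.sum_ite_eq', Finset.mem_univ, if_true]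
    have h1 := hsum fun _ => 1
    simp only [mul_one] at h1
    have h2 : ∑ i, m' i = ∑ i, m i + 1 := by exact_mod_cast h1
    have h3 := hmax m' (fun i => ?_) (by omega)
    · rw [hsum v] at h3
      linarith
    · have := hm i
      simp only [hm']
      split_ifs with e1
      · subst e1; omega
      · exact this

/-- A maximizer of a linear value does not use groups of negative value. -/
theorem eq_zero_of_isMax {M m : Fin K → ℕ} {n : ℕ} {v : Fin K → ℝ} (hm : ∀ k, m k ≤ M k)
    (hmn : ∑ k, m k ≤ n)
    (hmax : ∀ m' : Fin K → ℕ, (∀ k, m' k ≤ M k) → ∑ k, m' k ≤ n →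
      ∑ k, (m' k : ℝ) * v k ≤ ∑ k, (m k : ℝ) * v k)
    {k : Fin K} (hk : v k < 0) : m k = 0 := by
  set m' : Fin K → ℕ := fun i => if i = k then 0 else m i with hm'
  have hle : ∀ i, m' i ≤ m i := fun i => by simp only [hm']; split_ifs <;> omega
  have h1 := hmax m' (fun i => (hle i).trans (hm i))
    ((Finset.sum_le_sum fun i _ => hle i).trans hmn)
  have h2 : ∑ i, (m' i : ℝ) * v i = ∑ i, (m i : ℝ) * v i - m k * v k := by
    have hpt : ∀ i, (m' i : ℝ) * v i = m i * v i - (if i = k then m k * v k else 0) := by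
      intro i
      by_cases h : i = k
      · subst h; simp [hm']
      · simp [hm', h]
    simp only [hpt, Finset.sum_sub_distrib, Finset.sum_ite_eq', Finset.mem_univ, if_true]
  rw [h2] at h1
  by_contra hne
  have h3 : (0 : ℝ) < m k := by exact_mod_cast Nat.pos_of_ne_zero hne
  linarith [mul_neg_of_pos_of_neg h3 hk]

/-! ### Monotonicity of the increments of the potential -/

/-- A solution of the optimality recursion either is increasing or becomes negative. -/
theorem increments_mono_or_neg {lam : ℝ} (hlam : 0 < lam) {h : ℕ → ℝ} {φ : ℕ → ℝ → ℝ}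
    {G Φ : ℕ → ℝ}
    (h_convex : ∀ n, h (n + 1) - h n ≤ h (n + 2) - h (n + 1)) (h_top : Tendsto h atTop atTop)
    (hφ0 : ∀ x, φ 0 x = 0) (hφ : ∀ n, Monotone (φ n))
    (hψ : ∀ n, Monotone fun x => φ (n + 1) x - φ n x)
    (hconc : ∀ n x, φ (n + 2) x - φ (n + 1) x ≤ φ (n + 1) x - φ n x)
    (hΦ : ∀ n N, φ n (G N) ≤ Φ N)
    (hG : ∀ n, lam * G (n + 1) = η - h n + φ n (G n)) :
    (∀ n, 1 ≤ n → G n ≤ G (n + 1)) ∨ ∃ n, 1 ≤ n ∧ G n < 0 := by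
  by_cases hmono : ∀ n, 1 ≤ n → G n ≤ G (n + 1)
  · exact Or.inl hmono
  refine Or.inr ?_
  push Not at hmono
  classical
  obtain ⟨hN1, hNlt⟩ := Nat.find_spec hmono
  have hmin : ∀ m, 1 ≤ m → m < Nat.find hmono → G m ≤ G (m + 1) := fun m hm hlt =>
    not_lt.1 fun hcon => Nat.find_min hmono hlt ⟨hm, hcon⟩
  generalize Nat.find hmono = N at hN1 hNlt hmin
  obtain ⟨a, rfl⟩ := Nat.exists_eq_succ_of_ne_zero (Nat.one_le_iff_ne_zero.1 hN1)
  simp only [Nat.succ_eq_add_one] at *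
  -- From the first descent on, a further customer adds less service value than holding cost. The
  -- second clause makes the descent self-perpetuating: it survives smaller `x`, and it survives
  -- larger `n` by concavity of `φ` and convexity of `h`.
  have hdec : ∀ n, a + 1 ≤ n →
      G (n + 1) < G n ∧ φ (n + 1) (G n) - φ n (G n) < h (n + 1) - h n := by
    intro n hn
    induction n, hn using Nat.le_induction with
    | base =>
      refine ⟨hNlt, ?_⟩
      have h1 : φ a (G a) ≤ φ a (G (a + 1)) := by
        rcases a with _ | a
        · rw [hφ0, hφ0]
        · exact hφ _ (hmin (a + 1) (by omega) (by omega))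
      have h2 := mul_lt_mul_of_pos_left hNlt hlam
      rw [hG, hG] at h2
      linarith [hconc a (G (a + 1)), h_convex a]
    | succ n hn ih =>
      obtain ⟨ih1, ih2⟩ := ih
      have h1 := hφ (n + 1) ih1.le
      have h2 := hψ n ih1.le
      simp only at h2
      refine ⟨?_, by linarith [hconc n (G (n + 1)), h_convex n]⟩
      refine lt_of_mul_lt_mul_left ?_ hlam.le
      rw [hG, hG]
      linarith
  have hle : ∀ n, a + 1 ≤ n → G n ≤ G (a + 1) := by
    intro n hn
    induction n, hn using Nat.le_induction with
    | base => exact le_rfl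
    | succ n hn ih => exact (hdec n hn).1.le.trans ih
  obtain ⟨n, hn, han⟩ := ((h_top.eventually_gt_atTop (η + Φ (a + 1))).and
    (eventually_ge_atTop (a + 1))).exists
  refine ⟨n + 1, by omega, ?_⟩
  have h1 := hφ n (hle n han)
  have h2 := hΦ n (a + 1)
  have h3 : lam * G (n + 1) < 0 := by rw [hG]; linarith
  exact neg_of_mul_neg_right h3 hlam.le

/-- If `G` stayed below `B`, the service value would stay below `C`, and `η - h n + C → -∞` would
contradict `G n ≥ G 1`. -/
theorem increments_unbounded {lam : ℝ} {h : ℕ → ℝ} {φ : ℕ → ℝ → ℝ}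
    {G : ℕ → ℝ} (h_top : Tendsto h atTop atTop) (hφ : ∀ n, Monotone (φ n))
    {B C : ℝ} (hC : ∀ n, φ n B ≤ C) (hlam : 0 < lam)
    (hG : ∀ n, lam * G (n + 1) = η - h n + φ n (G n))
    (hmono : ∀ n, 1 ≤ n → G n ≤ G (n + 1)) : ∃ n, 1 ≤ n ∧ B < G n := by
  by_contra hcon
  push Not at hcon
  have hge : ∀ n, 1 ≤ n → G 1 ≤ G n := by
    intro n hn
    induction n, hn using Nat.le_induction with
    | base => exact le_rfl
    | succ n hn ih => exact ih.trans (hmono n hn)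
  obtain ⟨n, hn, h1n⟩ := ((h_top.eventually_gt_atTop (η + C - lam * G 1)).and
    (eventually_ge_atTop 1)).exists
  have h1 := hφ n (hcon n h1n)
  have h2 := mul_le_mul_of_nonneg_left (hge (n + 1) (by omega)) hlam.le
  linarith [hC n, hG n]

end GroupServerQueue

/-! ### The theorem -/

open GroupServerQueue

theorem theorem9 {K : ℕ} (Q : GroupServerQueue K)
    (hlam : 0 < Q.lam) (hmu : ∀ k, 0 < Q.mu k) (hc : ∀ k, 0 ≤ Q.c k)
    -- the holding cost is increasing, convex and unbounded
    (h_mono : Monotone Q.h)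
    (h_convex : ∀ n, Q.h (n + 1) - Q.h n ≤ Q.h (n + 2) - Q.h (n + 1))
    (h_top : Filter.Tendsto Q.h Filter.atTop Filter.atTop)
    -- different groups are heterogeneous
    (h_het : ∀ k l, k ≠ l → ¬(Q.c k = Q.c l ∧ Q.mu k = Q.mu l))
    -- scale economies
    (h_sorted : Monotone fun k => Q.c k / Q.mu k) (h_scale : Antitone Q.mu)
    (d : ℕ → Fin K → ℕ) (η : ℝ) (hd : Q.IsOptimal d η) :
    (∃ g, Q.IsPotential d η g) ∧
    ∀ g, Q.IsPotential d η g →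
      ∃ θ : Fin K → ℕ,
        (∀ k, IsLeast {n | 1 ≤ n ∧ Q.c k / Q.mu k < GroupServerQueue.prf g n} (θ k)) ∧
        Monotone θ ∧
        (∀ n k, θ k ≤ n → d n k = Q.maxOn d n k) ∧
        (∀ n k, n < θ k →
          d n k = 0 ∨ (1 ≤ n ∧ GroupServerQueue.prf g n = Q.c k / Q.mu k)) ∧
        ∃ d', Q.IsMultiThreshold θ d' ∧ Q.IsOptimal d' η := by
  have hR := hd.1.rates hlam hmu
  obtain ⟨w, hw, hs⟩ := hd.exists_weight hlam hmu hc h_mono h_top h_sorted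
  refine ⟨exists_isPotential hR hw hs, fun g hg => ?_⟩
  set G := prf g with hGdef
  have hG : ∀ n, Q.lam * G (n + 1) = Q.serviceRate (d n) * G n + η - Q.costRate n (d n) :=
    hg.lam_mul_prf_succ hR hw hs
  have hrate : ∀ n, 1 ≤ n → 0 < Q.serviceRate (d n) := fun n hn =>
    serviceRate_pos_of_weight hR hw hn
  have hmax : ∀ n, 1 ≤ n → ∀ m : Fin K → ℕ, (∀ k, m k ≤ Q.M k) → ∑ k, m k ≤ n →
      ∑ k, (m k : ℝ) * Q.serverValue (G n) k ≤ ∑ k, (d n k : ℝ) * Q.serverValue (G n) k := by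
    intro n hn m hm hmn
    have h1 := hd.bellman hlam hmu hw hs hG hn hm hmn
    linarith [serviceRate_mul_sub_costRate (Q := Q) n m (G n),
      serviceRate_mul_sub_costRate (Q := Q) n (d n) (G n)]
  have hfull : ∀ n k, 1 ≤ n → Q.c k / Q.mu k < G n → d n k = Q.maxOn d n k := by
    intro n k hn hk
    have hpos := (serverValue_pos_iff hmu (G n) k).2 hk
    exact eq_min_of_isMax (hd.1 n).1 (hd.1 n).2 (hmax n hn) hpos
      fun l hl => serverValue_lt hmu h_sorted h_scale h_het hl hpos
  have hnone : ∀ n k, 1 ≤ n → G n < Q.c k / Q.mu k → d n k = 0 := fun n k hn hk =>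
    eq_zero_of_isMax (hd.1 n).1 (hd.1 n).2 (hmax n hn) ((serverValue_neg_iff hmu (G n) k).2 hk)
  have hgreedy : ∀ n k, 1 ≤ n → Q.c k / Q.mu k < G n → d n k = Q.greedy n k := fun n k hn hk =>
    eq_greedy_of_eq_maxOn fun l hl => hfull n l hn ((h_sorted hl).trans_lt hk)
  -- Groups at a tie have value zero, so however many of their servers are on, the total is the
  -- same.
  have hvalue : ∀ n, ∑ k, (d n k : ℝ) * Q.serverValue (G n) k = Q.serviceValue n (G n) := by
    intro n
    refine Finset.sum_congr rfl fun k _ => ?_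
    rcases Nat.eq_zero_or_pos n with rfl | hn
    · simp [hd.1.apply_zero, greedy_zero]
    · rcases lt_trichotomy (Q.serverValue (G n) k) 0 with h | h | h
      · rw [hnone n k hn ((serverValue_neg_iff hmu _ _).1 h), max_eq_left h.le]
        simp
      · rw [h]; simp
      · rw [hgreedy n k hn ((serverValue_pos_iff hmu _ _).1 h), max_eq_right h.le]
  have hrec : ∀ n, Q.lam * G (n + 1) = η - Q.h n + Q.serviceValue n (G n) := by
    intro n
    linarith [hG n, hvalue n, serviceRate_mul_sub_costRate (Q := Q) n (d n) (G n)]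
  have hbound : ∀ n x, Q.serviceValue n x ≤ ∑ k, (Q.M k : ℝ) * max 0 (Q.serverValue x k) :=
    fun n x => Finset.sum_le_sum fun k _ => mul_le_mul_of_nonneg_right
      (Nat.cast_le.2 (min_le_left _ _)) (le_max_left _ _)
  have hstep : ∀ n, 1 ≤ n → G n ≤ G (n + 1) := by
    refine (increments_mono_or_neg hlam h_convex h_top (by simp [serviceValue, greedy_zero])
      (serviceValue_mono hmu) (serviceValue_diff_mono hmu)
      (serviceValue_concave hmu h_sorted h_scale)
      (fun n N => hbound n (G N)) hrec).resolve_right ?_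
    rintro ⟨n, hn, hneg⟩
    -- With `G n < 0` every group has negative value, so all are off, although every state `n ≥ 1`
    -- has a positive service rate.
    refine (hrate n hn).ne' ((serviceRate_eq_zero_iff hmu _).2 fun k => hnone n k hn ?_)
    exact hneg.trans_le (div_nonneg (hc k) (hmu k).le)
  have hGmono : ∀ m n, 1 ≤ m → m ≤ n → G m ≤ G n := by
    intro m n hm hmn
    induction n, hmn using Nat.le_induction with
    | base => exact le_rfl
    | succ n hn ih => exact ih.trans (hstep n (hm.trans hn))
  have hex : ∀ k, ∃ n, 1 ≤ n ∧ Q.c k / Q.mu k < G n := fun k =>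
    increments_unbounded h_top (serviceValue_mono hmu) (fun n => hbound n _) hlam hrec hstep
  classical
  have hleast : ∀ k, ∃ t, IsLeast {n | 1 ≤ n ∧ Q.c k / Q.mu k < G n} t := fun k =>
    ⟨Nat.find (hex k), Nat.find_spec (hex k), fun n hn => Nat.find_min' (hex k) hn⟩
  choose θ hθ using hleast
  have hθmono : Monotone θ := fun k l hkl =>
    (hθ k).2 ⟨(hθ l).1.1, (h_sorted hkl).trans_lt (hθ l).1.2⟩
  have habove : ∀ n k, θ k ≤ n → 1 ≤ n ∧ Q.c k / Q.mu k < G n := fun n k h =>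
    ⟨(hθ k).1.1.trans h, (hθ k).1.2.trans_le (hGmono _ _ (hθ k).1.1 h)⟩
  have hbelow : ∀ n k, 1 ≤ n → n < θ k → G n ≤ Q.c k / Q.mu k := fun n k hn h =>
    not_lt.1 fun hlt => h.not_ge ((hθ k).2 ⟨hn, hlt⟩)
  refine ⟨θ, hθ, hθmono, fun n k h => hfull n k (habove n k h).1 (habove n k h).2,
    fun n k h => ?_, fun n k => if θ k ≤ n then Q.greedy n k else 0, fun n k => ?_, ?_⟩
  · rcases Nat.eq_zero_or_pos n with rfl | hn
    · exact Or.inl (hd.1.apply_zero k)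
    · rcases (hbelow n k hn h).eq_or_lt with h1 | h1
      · exact Or.inr ⟨hn, h1⟩
      · exact Or.inl (hnone n k hn h1)
  · by_cases h : θ k ≤ n
    · simp only [h, if_true]
      exact (maxOn_eq_greedy fun l hl => if_pos ((hθmono hl.le).trans h)).symm
    · simp only [h, if_false]
  · obtain ⟨k₀, hk₀M, hk₀⟩ := exists_first_group hd.1 hmu (hrate 1 le_rfl)
    have hcost := holding_add_work_lt hd.1 hmu h_mono h_top hR hw hs
      fun l hl => h_sorted (hk₀ l hl)
    -- At `n = 0` the recursion reads `lam * G 1 = η - h 0`, which the cost bound makes larger than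
    -- `lam * (c k₀ / mu k₀)`. So group `k₀` has threshold `1`, and the threshold policy serves in
    -- every nonempty state.
    have hG1 : Q.c k₀ / Q.mu k₀ < G 1 := by
      have h1 := hrec 0
      simp only [serviceValue, greedy_zero, Nat.cast_zero, zero_mul, Finset.sum_const_zero,
        add_zero, zero_add] at h1
      refine lt_of_mul_lt_mul_left ?_ hlam.le
      rw [h1]
      linarith
    have hgreedy_le : ∀ n, ∑ k, Q.greedy n k ≤ n := fun n =>
      (sum_greedy_of_isLowerSet n Finset.univ fun _ _ l _ => Finset.mem_univ l).trans_le
        (min_le_right _ _)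
    -- Beyond the largest threshold every group is filled greedily under both policies, so they
    -- coincide.
    refine hd.of_same_potential hlam hmu hw hs hG (N := Finset.univ.sup θ) (fun n => ⟨?_, ?_⟩)
      (fun n => ?_) (fun n => ?_) fun n hn => ?_
    · intro k
      split_ifs
      · exact min_le_left _ _
      · exact Nat.zero_le _
    · refine (Finset.sum_le_sum fun k _ => ?_).trans (hgreedy_le n)
      split_ifs
      · exact le_rfl
      · exact Nat.zero_le _
    · refine (serviceRate_nonneg hmu _).lt_of_ne' fun h => ?_
      have h1 := (serviceRate_eq_zero_iff hmu _).1 h k₀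
      have h2 : θ k₀ ≤ n + 1 := ((hθ k₀).2 ⟨le_rfl, hG1⟩).trans (Nat.le_add_left 1 n)
      have h3 : ∑ l ∈ Finset.Iio k₀, Q.M l = 0 := Finset.sum_eq_zero fun l hl => by
        by_contra hne
        exact (hk₀ l (Nat.pos_of_ne_zero hne)).not_gt (Finset.mem_Iio.1 hl)
      simp only [h2, if_true, greedy, h3] at h1
      omega
    · have h1 := serviceRate_mul_sub_costRate (Q := Q) n
        (fun k => if θ k ≤ n then Q.greedy n k else 0) (G n)
      have h2 : ∑ k, ((if θ k ≤ n then Q.greedy n k else 0 : ℕ) : ℝ) * Q.serverValue (G n) k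
          = Q.serviceValue n (G n) := by
        refine Finset.sum_congr rfl fun k _ => ?_
        split_ifs with h
        · rw [max_eq_right ((serverValue_pos_iff hmu _ _).2 (habove n k h).2).le]
        · rcases Nat.eq_zero_or_pos n with rfl | hn
          · simp [greedy_zero]
          · rw [max_eq_left]
            · simp
            · exact not_lt.1 fun hlt => ((serverValue_pos_iff hmu _ _).1 hlt).not_ge
                (hbelow n k hn (not_le.1 h))
      linarith [hrec n]
    · funext k
      have h : θ k ≤ n := (Finset.le_sup (f := θ) (Finset.mem_univ k)).trans hn
      simp only [h, if_true]
      exact (hgreedy n k (habove n k h).1 (habove n k h).2).symm
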